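/- **Parameterized Implicit Function Theorem.** Let $H$ be a real Hilbert space with inner product $(\cdot,\cdot)_H$, norm $\|\cdot\|$ and origin $\theta$, and let $\mathscr{L}_s(H)$ be the space of bounded self-adjoint linear operators on $H$. Let $V\subset H$ be an open neighborhood of $\theta$ and let $\mathcal{L}\in C^1(V,\mathbb{R})$ with $\mathcal{L}'(\theta)=0$. Assume that the gradient $\nabla\mathcal{L}$ has a Gâteaux derivative $B(u)\in\mathscr{L}_s(H)$ at every $u\in V$, and that $B=P+Q$ on $V$, where for each $x\in V$ the operator $P(x)\in\mathscr{L}_s(H)$ is positive definite, $Q(x)\in\mathscr{L}_s(H)$ is compact, and - (D2) if $x_k\in V$ and $\|x_k\|\to0$, then $\|P(x_k)u-P(\theta)u\|\to 0$ for every $u\in H$; - (D3) $Q:V\to\mathscr{L}_s(H)$ is continuous at $\theta$ (in operator norm); - (D4) if $x_k\in V$ and $\|x_k\|\to0$, then there are $C_0>0$ and $k_0\in\mathbb{N}$ with $(P(x_k)u,u)_H\ge C_0\|u\|^2$ for all $u\in H$ and $k\ge k_0$. Let $H=H^+\oplus H^0\oplus H^-$ be the orthogonal decomposition into the positive definite,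 null and negative definite spaces of $B(\theta)$: $H^0=\ker B(\theta)$, $H^-$ is the closed span of the eigenvectors of $B(\theta)$ with negative eigenvalues, $H^+=(H^0\oplus H^-)^\perp$. Suppose that $H^0\neq\{\theta\}$. Let $P^0$ be the orthogonal projection onto $H^0$, $P^\perp=I-P^0$, let $B_E(\theta,\rho)$ be the open ball of radius $\rho$ about $\theta$ in $E$, and put $\mathcal{Q}_{r,s}=B_{H^+}(\theta,r)\oplus B_{H^-}(\theta,s)\subset (H^0)^\perp$. Let $\mathcal{G}_1,\dots,\mathcal{G}_n\in C^1(V,\mathbb{R})$ be such that, for each $j$, $\mathcal{G}_j'(\theta)=0$, the gradient $\nabla\mathcal{G}_j$ has a Gâteaux derivative $\mathcal{G}_j''(u)\in\mathscr{L}_s(H)$ at every $u\in V$, and $\mathcal{G}_j'':V\to\mathscr{L}_s(H)$ is continuous at $\theta$ (in operator norm). Then there are arbitrarily small $r,s,\epsilon>0$ (that is, for all $r_0,s_0,\epsilon_0>0$ one can choose $r\le r_0$, $s\le s_0$, $\epsilon\le\epsilon_0$) and a $\delta>0$ such that $z+u\in V$ for all $z\in H^0$ with $\|z\|\le\epsilon$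 and all $u\in\overline{\mathcal{Q}_{r,s}}$, and such that there is a unique continuous map $$\psi:[-\delta,\delta]^n\times (B_H(\theta,\epsilon)\cap H^0)\to\mathcal{Q}_{r,s}\subset (H^0)^\perp$$ with, for all $\vec\lambda=(\lambda_1,\dots,\lambda_n)\in[-\delta,\delta]^n$ and $z\in B_H(\theta,\epsilon)\cap H^0$, $\psi(\vec\lambda,\theta)=\theta$ and $$P^\perp\nabla\mathcal{L}(z+\psi(\vec\lambda,z))+\sum_{j=1}^n\lambda_jP^\perp\nabla\mathcal{G}_j(z+\psi(\vec\lambda,z))=\theta .$$ This $\psi$ satisfies $\|\psi(\vec\lambda,z_1)-\psi(\vec\lambda,z_2)\|\le 3\|z_1-z_2\|$ for all $\vec\lambda\in[-\delta,\delta]^n$ and $z_1,z_2\in B_H(\theta,\epsilon)\cap H^0$. Moreover, if a compact Lie group $G$ acts continuously on $H$ by linear isometries and $V$, $\mathcal{L}$ and all $\mathcal{G}_j$ are $G$-invariant, then $H^0$ and $(H^0)^\perp$ are $G$-invariant, $\nabla\mathcal{L}$ and $\nabla\mathcal{G}_j$ are $G$-equivariant on $V$, and $\psi$ is equivariant in $z$: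 $\psi(\vec\lambda,g\cdot z)=g\cdot\psi(\vec\lambda,z)$ for all $g\in G$, $\vec\lambda\in[-\delta,\delta]^n$ and $z\in B_H(\theta,\epsilon)\cap H^0$. -/

import Mathlib

open scoped Manifold ContDiff InnerProductSpace

noncomputable section

namespace Splitting

variable {H : Type*} [NormedAddCommGroup H] [InnerProductSpace ℝ H]

/-- The bounded linear operator `A` is the Gâteaux derivative of `F` at `u`: for every direction `v`
one has `(F (u + t v) - F u) / t → A v` in norm as `t → 0`. -/
def HasGateauxDerivAt (F : H → H) (A : H →L[ℝ] H) (u : H) : Prop :=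
  ∀ v : H, HasLineDerivAt ℝ F (A v) u v

/-- The null space `H⁰` of `A`. -/
def nullSpace (A : H →L[ℝ] H) : Submodule ℝ H :=
  LinearMap.ker (A : H →ₗ[ℝ] H)

/-- The negative definite space `H⁻` of `A`: the closed span of the eigenvectors that belong to
negative eigenvalues. (For the operators considered here, sums of a coercive and a compact
self-adjoint operator, the spectrum in `(-∞, 0]` consists of finitely many eigenvalues of finite
multiplicity, so this is the negative spectral subspace.) -/
def negSpace (A : H →L[ℝ] H) : Submodule ℝ H :=
  (⨆ μ : Set.Iio (0 : ℝ),
    Module.End.eigenspace (A : H →ₗ[ℝ] H) (μ : ℝ)).topologicalClosure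

/-- The positive definite space `H⁺` of `A`: the orthogonal complement of `H⁰ ⊕ H⁻`. -/
def posSpace (A : H →L[ℝ] H) : Submodule ℝ H :=
  (nullSpace A ⊔ negSpace A)ᗮ

/-- `Q_{r,s}`, the sum of the open ball of radius `r` in `H⁺` and the open ball of radius `s`
in `H⁻`. -/
def Qset (A : H →L[ℝ] H) (r s : ℝ) : Set H :=
  {u | ∃ p ∈ posSpace A, ∃ m ∈ negSpace A, ‖p‖ < r ∧ ‖m‖ < s ∧ u = p + m}

/-- The parameter domain `[-δ, δ]ⁿ × (B_H(0, ε) ∩ H⁰)`. -/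
def paramDomain (A : H →L[ℝ] H) (n : ℕ) (δ ε : ℝ) : Set ((Fin n → ℝ) × H) :=
  (Set.univ.pi fun _ : Fin n => Set.Icc (-δ) δ) ×ˢ
    (Metric.ball (0 : H) ε ∩ (nullSpace A : Set H))

variable [CompleteSpace H]

instance (A : H →L[ℝ] H) : CompleteSpace (nullSpace A) :=
  A.isClosed_ker.completeSpace_coe

/-- `P^⊥ = I - P⁰`, where `P⁰` is the orthogonal projection onto `H⁰`. -/
def perpProj (A : H →L[ℝ] H) : H →L[ℝ] H :=
  ContinuousLinearMap.id ℝ H - (nullSpace A).starProjection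

/-- The standing hypothesis on a functional `L` on an open neighbourhood `V` of the origin
(with `X = H`): `L` is `C¹` on `V` and critical at the origin, its gradient has the Gâteaux
derivative `B u` at every `u ∈ V`, and `B = P + Q` on `V` with `P` positive definite and
`Q` compact, subject to the conditions (D2), (D3), (D4) below. The condition (D1), that the
eigenvectors of `B 0` for non-positive eigenvalues lie in `X`, is void for `X = H`. -/
structure SplittingHypothesis (V : Set H) (L : H → ℝ) (B P Q : H → H →L[ℝ] H) : Prop where
  isOpen : IsOpen V
  zero_mem : (0 : H) ∈ V
  contDiffOn : ContDiffOn ℝ 1 L V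
  critical : fderiv ℝ L 0 = 0
  selfAdjoint_B : ∀ u ∈ V, IsSelfAdjoint (B u)
  gateaux : ∀ u ∈ V, HasGateauxDerivAt (gradient L) (B u) u
  decomp : ∀ x ∈ V, B x = P x + Q x
  selfAdjoint_P : ∀ x ∈ V, IsSelfAdjoint (P x)
  posDef_P : ∀ x ∈ V, ∀ u : H, u ≠ 0 → 0 < ⟪P x u, u⟫_ℝ
  selfAdjoint_Q : ∀ x ∈ V, IsSelfAdjoint (Q x)
  compact_Q : ∀ x ∈ V, IsCompactOperator (Q x)
  /-- (D2) -/
  D2 : ∀ x : ℕ → H, (∀ k, x k ∈ V) →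
    Filter.Tendsto (fun k => ‖x k‖) Filter.atTop (nhds 0) →
    ∀ u : H, Filter.Tendsto (fun k => ‖P (x k) u - P 0 u‖) Filter.atTop (nhds 0)
  /-- (D3), with the operator norm on the values of `Q` -/
  D3 : ContinuousWithinAt Q V 0
  /-- (D4) -/
  D4 : ∀ x : ℕ → H, (∀ k, x k ∈ V) →
    Filter.Tendsto (fun k => ‖x k‖) Filter.atTop (nhds 0) →
    ∃ C₀ : ℝ, 0 < C₀ ∧ ∃ k₀ : ℕ, ∀ k ≥ k₀, ∀ u : H, C₀ * ‖u‖ ^ 2 ≤ ⟪P (x k) u, u⟫_ℝ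

/-- The hypothesis on a perturbation `G`: it is `C¹` on `V` and critical at the origin, its
gradient has the self-adjoint Gâteaux derivative `G'' u` at every `u ∈ V`, and `G''` is
continuous at the origin (in operator norm). -/
structure PerturbationHypothesis (V : Set H) (G : H → ℝ) (G'' : H → H →L[ℝ] H) : Prop where
  contDiffOn : ContDiffOn ℝ 1 G V
  critical : fderiv ℝ G 0 = 0
  selfAdjoint : ∀ u ∈ V, IsSelfAdjoint (G'' u)
  gateaux : ∀ u ∈ V, HasGateauxDerivAt (gradient G) (G'' u) u
  continuousAt : ContinuousWithinAt G'' V 0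

/-- `ψ` is a continuous map `[-δ, δ]ⁿ × (B_H(0, ε) ∩ H⁰) → Q_{r,s}` with `ψ(λ, 0) = 0` and
`P^⊥∇L(z + ψ(λ, z)) + ∑ⱼ λⱼ P^⊥∇Gⱼ(z + ψ(λ, z)) = 0` (values of `ψ` outside of the
domain are irrelevant); here `A = B(0)`. -/
structure IsImplicitMap (A : H →L[ℝ] H) (L : H → ℝ) {n : ℕ} (G : Fin n → H → ℝ)
    (r s ε δ : ℝ) (ψ : (Fin n → ℝ) × H → H) : Prop where
  continuousOn : ContinuousOn ψ (paramDomain A n δ ε)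
  mapsTo : Set.MapsTo ψ (paramDomain A n δ ε) (Qset A r s)
  map_zero : ∀ p ∈ paramDomain A n δ ε, ψ (p.1, 0) = 0
  equation : ∀ p ∈ paramDomain A n δ ε,
    perpProj A (gradient L (p.2 + ψ p)) +
      ∑ j, p.1 j • perpProj A (gradient (G j) (p.2 + ψ p)) = 0

end Splitting

end

/-!
The projected equation `P^⊥ f_λ (z + u) = 0`, with `f_λ = ∇L + ∑ⱼ λⱼ ∇Gⱼ` and the unknown `u` in the
orthogonal complement of the null space of `A = B 0`, becomes strongly monotone after a sign flip.
Let `S` be the isometric involution that is `-1` on the negative space `H⁻` of `A` and `1` on its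
orthogonal complement. If `D` is self-adjoint with `⟪D p, p⟫ ≥ c ‖p‖²` on `H⁺` and
`⟪D m, m⟫ ≤ -c ‖m‖²` on `H⁻`, then the cross terms cancel in `⟪D w, S w⟫`, which is therefore at
least `c ‖w‖²` for `w ∈ H⁺ ⊕ H⁻` (`IsNearby.le_inner_signFlip`). By the mean value theorem along
segments, for which a Gâteaux derivative is enough, `S P^⊥ f_λ (z + ·)` is strongly monotone near the
origin as soon as the Hessians satisfy these bounds there. They are also bounded near the origin
(uniform boundedness principle), so `f_λ` is Lipschitz and a gradient step with a suitable constant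
is a contraction: this gives a solution (`exists_perpProj_eq_zero`). Monotonicity compares the
solutions for two parameters (`mul_norm_sub_le`), which yields uniqueness, continuity and, since the
Hessians are small on the null space of `A`, the Lipschitz bound. Equivariance follows from
uniqueness.

The uniform bounds on the Hessians near the origin (`SplittingHypothesis.exists_isNearby`) hold
although `P` is continuous only strongly. On `H⁺` they follow from weak lower semicontinuity: along
weakly convergent unit vectors the compact part passes to the limit, and the uniformly coercive part
gains `C (1 - ‖w‖²)` from the norm lost in the limit `w` (`le_of_weakLimit`). On `H⁻` and `H⁰`, where
the form of `A` is non-positive, weak convergence is strong (`tendsto_of_weakLimit_of_nonpos`), so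
that `B x` converges to `A` uniformly on the unit ball. Ultrafilters replace the passage to weakly
convergent subsequences.
-/

namespace Splitting

open Filter Topology

/-! ### Weak limits along ultrafilters -/

section

variable {H : Type*} [NormedAddCommGroup H] [InnerProductSpace ℝ H]

/-- Weak compactness of the unit ball: along an ultrafilter, which replaces the passage to
subsequences, every family in the unit ball converges weakly. -/
theorem exists_weakLimit [CompleteSpace H] {ι : Type*} (U : Ultrafilter ι) {u : ι → H}
    (hu : ∀ i, ‖u i‖ ≤ 1) : ∃ w : H, ∀ v, Tendsto (fun i => ⟪u i, v⟫_ℝ) U (𝓝 ⟪w, v⟫_ℝ) := by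
  have hK := WeakDual.isCompact_closedBall (𝕜 := ℝ) (E := H) 0 1
  let φ : ι → WeakDual ℝ H := fun i => StrongDual.toWeakDual (InnerProductSpace.toDual ℝ H (u i))
  have hφ : ∀ i, φ i ∈ WeakDual.toStrongDual ⁻¹' Metric.closedBall (0 : StrongDual ℝ H) 1 := by
    intro i
    simpa [φ] using hu i
  obtain ⟨y, -, hy⟩ := isCompact_iff_ultrafilter_le_nhds.1 hK (U.map φ)
    (by
      rw [le_principal_iff]
      exact Filter.mem_map.2 (Filter.Eventually.of_forall hφ))
  refine ⟨(InnerProductSpace.toDual ℝ H).symm (WeakDual.toStrongDual y), fun v => ?_⟩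
  have h1 : Tendsto φ U (𝓝 y) := hy
  have h2 := ((WeakDual.eval_continuous v).tendsto y).comp h1
  rw [InnerProductSpace.toDual_symm_apply]
  exact h2

variable {ι : Type*} {l : Filter ι} {u : ι → H} {w : H}

theorem weakLimit_mem [CompleteSpace H] [l.NeBot]
    (hw : ∀ v, Tendsto (fun i => ⟪u i, v⟫_ℝ) l (𝓝 ⟪w, v⟫_ℝ))
    (W : Submodule ℝ H) (hW : IsClosed (W : Set H)) (hu : ∀ i, u i ∈ W) : w ∈ W := by
  have : CompleteSpace W := hW.completeSpace_coe
  rw [← W.orthogonal_orthogonal, Submodule.mem_orthogonal']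
  intro v hv
  refine tendsto_nhds_unique (hw v) ?_
  have : (fun i => ⟪u i, v⟫_ℝ) = fun _ => 0 := by
    funext i
    exact hv _ (hu i)
  rw [this]
  exact tendsto_const_nhds

/-- The inner product of a strongly and a weakly convergent bounded family converges. -/
theorem tendsto_inner_of_weakLimit
    (hw : ∀ v, Tendsto (fun i => ⟪u i, v⟫_ℝ) l (𝓝 ⟪w, v⟫_ℝ)) (hu : ∀ i, ‖u i‖ ≤ 1)
    {a : ι → H} {a₀ : H} (ha : Tendsto a l (𝓝 a₀)) :
    Tendsto (fun i => ⟪a i, u i⟫_ℝ) l (𝓝 ⟪a₀, w⟫_ℝ) := by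
  have h1 : Tendsto (fun i => ⟪a i - a₀, u i⟫_ℝ) l (𝓝 0) := by
    refine squeeze_zero_norm (a := fun i => ‖a i - a₀‖) (fun i => ?_)
      (tendsto_iff_norm_sub_tendsto_zero.1 ha)
    exact (norm_inner_le_norm _ _).trans
      (mul_le_of_le_one_right (norm_nonneg _) (hu i))
  have h2 := h1.add (hw a₀)
  rw [zero_add, real_inner_comm] at h2
  refine h2.congr fun i => ?_
  rw [inner_sub_left, real_inner_comm a₀ (u i)]
  ring

/-- A compact operator turns weak into strong convergence. -/
theorem tendsto_compact_of_weakLimit [CompleteSpace H] {U : Ultrafilter ι}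
    (hw : ∀ v, Tendsto (fun i => ⟪u i, v⟫_ℝ) U (𝓝 ⟪w, v⟫_ℝ)) (hu : ∀ i, ‖u i‖ ≤ 1)
    {T : H →L[ℝ] H} (hT : IsCompactOperator T) :
    Tendsto (fun i => T (u i)) U (𝓝 (T w)) := by
  obtain ⟨K, hK, hTK⟩ := IsCompactOperator.image_subset_compact_of_bounded
    (f := (T : H →ₗ[ℝ] H)) hT (Metric.isBounded_closedBall (x := (0 : H)) (r := 1))
  have hmem : ∀ i, T (u i) ∈ K := fun i => hTK ⟨u i, by simpa using hu i, rfl⟩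
  obtain ⟨y, -, hy⟩ := isCompact_iff_ultrafilter_le_nhds.1 hK (U.map fun i => T (u i))
    (by
      rw [le_principal_iff]
      exact Filter.mem_map.2 (Filter.Eventually.of_forall hmem))
  have h1 : Tendsto (fun i => T (u i)) U (𝓝 y) := hy
  -- the strong limit is also the weak limit
  have h2 : y = T w := by
    refine ext_inner_right ℝ fun v => ?_
    have h3 : Tendsto (fun i => ⟪T (u i), v⟫_ℝ) U (𝓝 ⟪y, v⟫_ℝ) := h1.inner tendsto_const_nhds
    have h4 := hw (T.adjoint v)
    simp only [ContinuousLinearMap.adjoint_inner_right] at h4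
    exact tendsto_nhds_unique h3 h4
  rwa [h2] at h1

theorem tendsto_norm_sub_sq_of_weakLimit
    (hw : ∀ v, Tendsto (fun i => ⟪u i, v⟫_ℝ) l (𝓝 ⟪w, v⟫_ℝ)) (hu : ∀ i, ‖u i‖ = 1) :
    Tendsto (fun i => ‖u i - w‖ ^ 2) l (𝓝 (1 - ‖w‖ ^ 2)) := by
  have h := ((hw w).const_mul (-2)).const_add (1 + ‖w‖ ^ 2)
  rw [real_inner_self_eq_norm_sq] at h
  refine (h.congr fun i => ?_).trans (le_of_eq (by congr 1; ring))
  rw [norm_sub_sq_real, hu i]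
  ring

/-- Weak lower semicontinuity, with a gain of `C (1 - ‖w‖²)` for the norm lost in the limit, of the
quadratic forms of uniformly coercive operators that converge strongly, perturbed by operators that
converge in norm to a compact one. -/
theorem le_of_weakLimit [CompleteSpace H] {U : Ultrafilter ι}
    (hw : ∀ v, Tendsto (fun i => ⟪u i, v⟫_ℝ) U (𝓝 ⟪w, v⟫_ℝ)) (hu : ∀ i, ‖u i‖ = 1)
    {P Q : ι → H →L[ℝ] H} {P₀ Q₀ : H →L[ℝ] H} {C c : ℝ} {b : ι → ℝ}
    (hP : ∀ v, Tendsto (fun i => P i v) U (𝓝 (P₀ v)))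
    (hPs : ∀ᶠ i in (U : Filter ι), IsSelfAdjoint (P i))
    (hPC : ∀ᶠ i in (U : Filter ι), ∀ v, C * ‖v‖ ^ 2 ≤ ⟪P i v, v⟫_ℝ)
    (hQ : Tendsto Q U (𝓝 Q₀)) (hQ₀ : IsCompactOperator Q₀)
    (hb : Tendsto b U (𝓝 c))
    (hle : ∀ᶠ i in (U : Filter ι), ⟪(P i + Q i) (u i), u i⟫_ℝ ≤ b i) :
    ‖w‖ ≤ 1 ∧ C * (1 - ‖w‖ ^ 2) + ⟪(P₀ + Q₀) w, w⟫_ℝ ≤ c := by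
  have hu' : ∀ i, ‖u i‖ ≤ 1 := fun i => (hu i).le
  have hn := tendsto_norm_sub_sq_of_weakLimit hw hu
  constructor
  · have : 0 ≤ 1 - ‖w‖ ^ 2 := ge_of_tendsto' hn fun i => by positivity
    nlinarith [norm_nonneg w]
  have hQu : Tendsto (fun i => Q i (u i)) U (𝓝 (Q₀ w)) := by
    have h1 : Tendsto (fun i => (Q i - Q₀) (u i)) U (𝓝 0) := by
      refine squeeze_zero_norm (a := fun i => ‖Q i - Q₀‖) (fun i => ?_)
        (tendsto_iff_norm_sub_tendsto_zero.1 hQ)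
      exact ((Q i - Q₀).le_opNorm _).trans (by rw [hu i, mul_one])
    have h2 := h1.add (tendsto_compact_of_weakLimit hw hu' hQ₀)
    rw [zero_add] at h2
    refine h2.congr fun i => ?_
    simp
  have h1 := tendsto_inner_of_weakLimit hw hu' hQu
  have h2 := tendsto_inner_of_weakLimit hw hu' (hP w)
  have h3 : Tendsto (fun i => ⟪P i w, w⟫_ℝ) U (𝓝 ⟪P₀ w, w⟫_ℝ) := (hP w).inner tendsto_const_nhds
  have h4 := (((hn.const_mul C).add (h2.const_mul 2)).sub h3).add h1
  have h5 : C * (1 - ‖w‖ ^ 2) + 2 * ⟪P₀ w, w⟫_ℝ - ⟪P₀ w, w⟫_ℝ + ⟪Q₀ w, w⟫_ℝ ≤ c := by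
    refine le_of_tendsto_of_tendsto h4 hb ?_
    filter_upwards [hPs, hPC, hle] with i hs hC hi
    have h6 := hC (u i - w)
    have h7 : ⟪P i (u i), w⟫_ℝ = ⟪P i w, u i⟫_ℝ := by
      rw [real_inner_comm]
      exact (hs.isSymmetric w (u i)).symm
    simp only [map_sub, inner_sub_left, inner_sub_right, h7] at h6
    simp only [add_apply, inner_add_left] at hi
    linarith
  simp only [add_apply, inner_add_left]
  linarith

/-- On a subspace where the form of `P₀ + Q₀` is non-positive, with `P₀` coercive and `Q₀` compact,
weak convergence is strong. -/
theorem tendsto_of_weakLimit_of_nonpos [CompleteSpace H] {U : Ultrafilter ι}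
    (hw : ∀ v, Tendsto (fun i => ⟪u i, v⟫_ℝ) U (𝓝 ⟪w, v⟫_ℝ)) (hu : ∀ i, ‖u i‖ = 1)
    {P₀ Q₀ : H →L[ℝ] H} {C : ℝ} (hC : 0 < C) (hPC : ∀ v, C * ‖v‖ ^ 2 ≤ ⟪P₀ v, v⟫_ℝ)
    (hQ₀ : IsCompactOperator Q₀) (W : Submodule ℝ H)
    (hW : ∀ v ∈ W, ⟪(P₀ + Q₀) v, v⟫_ℝ ≤ 0) (huW : ∀ i, u i ∈ W) (hwW : w ∈ W) :
    Tendsto u U (𝓝 w) := by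
  have hu' : ∀ i, ‖u i‖ ≤ 1 := fun i => (hu i).le
  have hQ : Tendsto (fun i => Q₀ (u i - w)) U (𝓝 0) := by
    have h := (tendsto_compact_of_weakLimit hw hu' hQ₀).sub_const (Q₀ w)
    rw [sub_self] at h
    exact h.congr fun i => (map_sub _ _ _).symm
  have h1 : Tendsto (fun i => ⟪Q₀ (u i - w), u i - w⟫_ℝ) U (𝓝 0) := by
    have h2 := tendsto_inner_of_weakLimit hw hu' hQ
    have h3 : Tendsto (fun i => ⟪Q₀ (u i - w), w⟫_ℝ) U (𝓝 ⟪(0 : H), w⟫_ℝ) :=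
      hQ.inner tendsto_const_nhds
    have h4 := h2.sub h3
    rw [sub_self] at h4
    exact h4.congr fun i => (inner_sub_right _ _ _).symm
  have h2 : Tendsto (fun i => ‖u i - w‖ ^ 2) U (𝓝 0) := by
    have h3 := h1.const_mul (-C⁻¹)
    rw [mul_zero] at h3
    refine squeeze_zero (fun i => by positivity) (fun i => ?_) h3
    have h4 := hPC (u i - w)
    have h5 := hW _ (W.sub_mem (huW i) hwW)
    simp only [add_apply, inner_add_left] at h5
    rw [neg_mul, ← mul_neg, inv_mul_eq_div, le_div_iff₀ hC]
    linarith
  rw [tendsto_iff_norm_sub_tendsto_zero]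
  have h3 := h2.sqrt
  simpa using h3

end

/-! ### The null, negative and positive space of a self-adjoint operator -/

section

variable {H : Type*} [NormedAddCommGroup H] [InnerProductSpace ℝ H] {A : H →L[ℝ] H}

theorem mem_nullSpace {u : H} : u ∈ nullSpace A ↔ A u = 0 := LinearMap.mem_ker

theorem isClosed_nullSpace : IsClosed (nullSpace A : Set H) := A.isClosed_ker

theorem isClosed_negSpace : IsClosed (negSpace A : Set H) := Submodule.isClosed_topologicalClosure _

theorem isClosed_posSpace : IsClosed (posSpace A : Set H) := Submodule.isClosed_orthogonal _

instance [CompleteSpace H] : CompleteSpace (negSpace A) := isClosed_negSpace.completeSpace_coe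

theorem eigenvector_mem_negSpace {μ : ℝ} (hμ : μ < 0) {u : H} (hu : A u = μ • u) :
    u ∈ negSpace A := by
  refine Submodule.le_topologicalClosure _ ?_
  exact Submodule.mem_iSup_of_mem (⟨μ, hμ⟩ : Set.Iio (0 : ℝ)) (Module.End.mem_eigenspace_iff.2 hu)

/-- A closed subspace contains the negative space as soon as it contains the eigenvectors. -/
theorem negSpace_le {W : Submodule ℝ H} (hW : IsClosed (W : Set H))
    (h : ∀ μ < (0 : ℝ), ∀ u, A u = μ • u → u ∈ W) : negSpace A ≤ W := by
  refine Submodule.topologicalClosure_minimal _ (iSup_le fun μ u hu => ?_) hW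
  exact h μ μ.2 u (Module.End.mem_eigenspace_iff.1 hu)

/-- A bounded operator commuting with `A` preserves the negative space of `A`. -/
theorem map_mem_negSpace {T : H →L[ℝ] H} (hT : ∀ u, A (T u) = T (A u)) {u : H}
    (hu : u ∈ negSpace A) : T u ∈ negSpace A := by
  have h : negSpace A ≤ (negSpace A).comap (T : H →ₗ[ℝ] H) := by
    refine negSpace_le (isClosed_negSpace.preimage T.continuous) fun μ hμ v hv => ?_
    refine eigenvector_mem_negSpace hμ ?_
    change A (T v) = μ • T v
    rw [hT, hv, map_smul]
  exact h hu

theorem posSpace_le_nullSpace_orthogonal : posSpace A ≤ (nullSpace A)ᗮ :=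
  Submodule.orthogonal_le le_sup_left

theorem mem_posSpace_of_inf {u : H} (h₀ : u ∈ (nullSpace A)ᗮ) (h₁ : u ∈ (negSpace A)ᗮ) :
    u ∈ posSpace A := by
  rw [posSpace, ← Submodule.inf_orthogonal]
  exact ⟨h₀, h₁⟩

section SelfAdjoint

variable [CompleteSpace H]

theorem inner_map_eq (hA : IsSelfAdjoint A) (u v : H) : ⟪A u, v⟫_ℝ = ⟪u, A v⟫_ℝ := hA.isSymmetric u v

theorem negSpace_le_nullSpace_orthogonal (hA : IsSelfAdjoint A) : negSpace A ≤ (nullSpace A)ᗮ := by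
  refine negSpace_le (Submodule.isClosed_orthogonal _) fun μ hμ u hu => ?_
  rw [Submodule.mem_orthogonal']
  intro v hv
  have h := inner_map_eq hA u v
  rw [hu, mem_nullSpace.1 hv, inner_zero_right, real_inner_smul_left] at h
  exact (mul_eq_zero.1 h).resolve_left hμ.ne

theorem map_mem_orthogonal (hA : IsSelfAdjoint A) {W : Submodule ℝ H}
    (hW : ∀ v ∈ W, A v ∈ W) {u : H} (hu : u ∈ Wᗮ) :
    A u ∈ Wᗮ := by
  rw [Submodule.mem_orthogonal'] at hu ⊢
  intro v hv
  rw [inner_map_eq hA]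
  exact hu _ (hW v hv)

theorem map_mem_posSpace (hA : IsSelfAdjoint A) {u : H} (hu : u ∈ posSpace A) :
    A u ∈ posSpace A := by
  refine map_mem_orthogonal hA (fun v hv => ?_) hu
  obtain ⟨z, hz, m, hm, rfl⟩ := Submodule.mem_sup.1 hv
  rw [map_add, mem_nullSpace.1 hz, zero_add]
  exact Submodule.mem_sup_right (map_mem_negSpace (fun _ => rfl) hm)

theorem inner_nonpos_of_mem_negSpace (hA : IsSelfAdjoint A) {u : H} (hu : u ∈ negSpace A) :
    ⟪A u, u⟫_ℝ ≤ 0 := by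
  have hcl : IsClosed {u : H | ⟪A u, u⟫_ℝ ≤ 0} :=
    isClosed_le (A.continuous.inner continuous_id) continuous_const
  refine hcl.closure_subset_iff.2 (fun v hv => ?_) hu
  obtain ⟨f, hf, rfl⟩ := (Submodule.mem_iSup_iff_exists_finsupp _ _).1 hv
  have hAf : ∀ μ, A (f μ) = (μ : ℝ) • f μ := fun μ => Module.End.mem_eigenspace_iff.1 (hf μ)
  have horth : ∀ μ ν, μ ≠ ν → ⟪f μ, f ν⟫_ℝ = 0 := by
    intro μ ν hμν
    have h := inner_map_eq hA (f μ) (f ν)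
    rw [hAf, hAf, real_inner_smul_left, real_inner_smul_right, ← sub_eq_zero, ← sub_mul] at h
    exact (mul_eq_zero.1 h).resolve_left (sub_ne_zero.2 fun h' => hμν (Subtype.ext h'))
  change ⟪A (f.sum fun _ x => x), f.sum fun _ x => x⟫_ℝ ≤ 0
  rw [Finsupp.sum, map_sum, sum_inner]
  refine Finset.sum_nonpos fun μ hμ => ?_
  rw [inner_sum, Finset.sum_eq_single μ, hAf, real_inner_smul_left]
  · exact mul_nonpos_of_nonpos_of_nonneg (le_of_lt μ.2) real_inner_self_nonneg
  · intro ν _ hν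
    rw [hAf, real_inner_smul_left, horth μ ν hν.symm, mul_zero]
  · exact fun h => absurd hμ h

/-- If the form of `A` is non-negative on `W` and vanishes at `w ∈ W`, then `w` is in its
radical. -/
theorem inner_eq_zero_of_isotropic (hA : IsSelfAdjoint A) {W : Submodule ℝ H}
    (hW : ∀ v ∈ W, 0 ≤ ⟪A v, v⟫_ℝ) {w v : H} (hw : w ∈ W) (hv : v ∈ W) (h : ⟪A w, w⟫_ℝ ≤ 0) : ⟪A w, v⟫_ℝ = 0 := by
  have h1 : ∀ t : ℝ, 0 ≤ ⟪A v, v⟫_ℝ * (t * t) + 2 * ⟪A w, v⟫_ℝ * t + 0 := by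
    intro t
    have h2 := hW _ (W.add_mem hw (W.smul_mem t hv))
    have h3 : ⟪A v, w⟫_ℝ = ⟪A w, v⟫_ℝ := by rw [inner_map_eq hA, real_inner_comm]
    simp only [map_add, map_smul, inner_add_left, inner_add_right, real_inner_smul_left,
      real_inner_smul_right, h3] at h2
    linarith
  have h4 := discrim_le_zero h1
  rw [discrim] at h4
  nlinarith

/-- If the form of `A` is non-negative on the invariant subspace `W` and vanishes at `w ∈ W`, then
`A w = 0`. -/
theorem map_eq_zero_of_isotropic (hA : IsSelfAdjoint A) {W : Submodule ℝ H}
    (hW : ∀ v ∈ W, 0 ≤ ⟪A v, v⟫_ℝ)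
    (hAW : ∀ v ∈ W, A v ∈ W) {w : H} (hw : w ∈ W) (h : ⟪A w, w⟫_ℝ ≤ 0) : A w = 0 :=
  inner_self_eq_zero.1 (inner_eq_zero_of_isotropic hA hW hw (hAW w hw) h)

end SelfAdjoint

/-! ### Coercivity of a positive plus a compact operator -/

theorem mul_norm_sq_le_of_unit {W : Submodule ℝ H} {T : H →L[ℝ] H} {a : ℝ}
    (h : ∀ v ∈ W, ‖v‖ = 1 → a ≤ ⟪T v, v⟫_ℝ) {v : H} (hv : v ∈ W) :
    a * ‖v‖ ^ 2 ≤ ⟪T v, v⟫_ℝ := by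
  rcases eq_or_ne v 0 with rfl | hv0
  · simp
  have hn : 0 < ‖v‖ := norm_pos_iff.2 hv0
  have h1 := h (‖v‖⁻¹ • v) (W.smul_mem _ hv) (norm_smul_inv_norm hv0)
  rw [map_smul, real_inner_smul_left, real_inner_smul_right, ← mul_assoc, ← sq,
    inv_pow, inv_mul_eq_div, le_div_iff₀ (by positivity)] at h1
  exact h1

section Coercive

variable [CompleteSpace H] {P Q : H →L[ℝ] H} {C : ℝ}

/-- The form of `P + Q` is coercive on the positive space: by weak lower semicontinuity it attains
its infimum on the unit sphere there if this is non-positive, and a minimizer is an eigenvector. -/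
theorem exists_coercive_posSpace (hP : IsSelfAdjoint P) (hQ : IsSelfAdjoint Q)
    (hC : 0 < C) (hPC : ∀ v, C * ‖v‖ ^ 2 ≤ ⟪P v, v⟫_ℝ) (hQc : IsCompactOperator Q) :
    ∃ a : ℝ, 0 < a ∧ ∀ u ∈ posSpace (P + Q), a * ‖u‖ ^ 2 ≤ ⟪(P + Q) u, u⟫_ℝ := by
  have hA : IsSelfAdjoint (P + Q) := hP.add hQ
  set A := P + Q with hAdef
  let S : Set ℝ := (fun u => ⟪A u, u⟫_ℝ) '' {u | u ∈ posSpace A ∧ ‖u‖ = 1}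
  rcases S.eq_empty_or_nonempty with hS | hS
  · refine ⟨1, one_pos, fun u hu => mul_norm_sq_le_of_unit (fun v hv hv1 => ?_) hu⟩
    exact absurd (Set.mem_image_of_mem (fun u => ⟪A u, u⟫_ℝ) (show v ∈ {u | u ∈ posSpace A ∧ ‖u‖ = 1}
      from ⟨hv, hv1⟩)) (by rw [show _ '' _ = S from rfl, hS]; exact Set.notMem_empty _)
  have hbdd : BddBelow S := by
    refine ⟨-‖A‖, ?_⟩
    rintro _ ⟨u, ⟨-, hu⟩, rfl⟩
    have h1 := (abs_le.1 (abs_real_inner_le_norm (A u) u)).1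
    have h2 := A.le_opNorm u
    rw [hu, mul_one] at h1 h2
    change -‖A‖ ≤ ⟪A u, u⟫_ℝ
    linarith
  set m := sInf S with hm
  have hlow : ∀ v ∈ posSpace A, m * ‖v‖ ^ 2 ≤ ⟪A v, v⟫_ℝ := fun v hv =>
    mul_norm_sq_le_of_unit (fun v hv hv1 => csInf_le hbdd ⟨v, ⟨hv, hv1⟩, rfl⟩) hv
  by_cases hm0 : 0 < m
  · exact ⟨m, hm0, hlow⟩
  exfalso
  rw [not_lt] at hm0
  obtain ⟨b, -, hb, hbS⟩ := exists_seq_tendsto_sInf hS hbdd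
  choose u hu hub using hbS
  let U : Ultrafilter ℕ := hyperfilter ℕ
  have hU : (U : Filter ℕ) ≤ atTop := Nat.hyperfilter_le_atTop
  obtain ⟨w, hw⟩ := exists_weakLimit U (fun i => (hu i).2.le)
  have hwW : w ∈ posSpace A := weakLimit_mem hw _ isClosed_posSpace fun i => (hu i).1
  obtain ⟨hw1, hwle⟩ := le_of_weakLimit (P := fun _ => P) (Q := fun _ => Q) hw (fun i => (hu i).2)
    (fun _ => tendsto_const_nhds) (Eventually.of_forall fun _ => hP)
    (Eventually.of_forall fun _ => hPC) tendsto_const_nhds hQc (hb.mono_left hU)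
    (Eventually.of_forall fun i => (hub i).le)
  rw [← hAdef, ← hm] at hwle
  have h1 := hlow w hwW
  have hw2 : ‖w‖ ^ 2 = 1 := by
    have : ‖w‖ ^ 2 ≤ 1 := by nlinarith [norm_nonneg w]
    nlinarith
  -- the weak limit minimizes the Rayleigh quotient, hence is an eigenvector for `m ≤ 0`
  have hT : IsSelfAdjoint (A - m • ContinuousLinearMap.id ℝ H) :=
    hA.sub ((IsSelfAdjoint.all m).smul (IsSelfAdjoint.one (H →L[ℝ] H)))
  have hTw := map_eq_zero_of_isotropic (W := posSpace A) hT
    (fun v hv => by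
      have := hlow v hv
      simp only [sub_apply, smul_apply, ContinuousLinearMap.id_apply, inner_sub_left,
        real_inner_smul_left, real_inner_self_eq_norm_sq]
      linarith)
    (fun v hv => Submodule.sub_mem _ (map_mem_posSpace hA hv) (Submodule.smul_mem _ _ hv)) hwW
    (by
      simp only [sub_apply, smul_apply, ContinuousLinearMap.id_apply, inner_sub_left,
        real_inner_smul_left, real_inner_self_eq_norm_sq, hw2]
      rw [hw2] at hwle
      linarith)
  have hAw : A w = m • w := sub_eq_zero.1 hTw
  have hmem : w ∈ nullSpace A ⊔ negSpace A := by
    rcases hm0.lt_or_eq with h | h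
    · exact Submodule.mem_sup_right (eigenvector_mem_negSpace h hAw)
    · exact Submodule.mem_sup_left (mem_nullSpace.2 (by rw [hAw, h, zero_smul]))
  have h0 : ⟪w, w⟫_ℝ = 0 := hwW w hmem
  rw [real_inner_self_eq_norm_sq, hw2] at h0
  exact one_ne_zero h0

/-- The form of `P + Q` is negative definite, uniformly, on the negative space. -/
theorem exists_coercive_negSpace (hP : IsSelfAdjoint P) (hQ : IsSelfAdjoint Q)
    (hC : 0 < C) (hPC : ∀ v, C * ‖v‖ ^ 2 ≤ ⟪P v, v⟫_ℝ) (hQc : IsCompactOperator Q) :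
    ∃ a : ℝ, 0 < a ∧ ∀ u ∈ negSpace (P + Q), ⟪(P + Q) u, u⟫_ℝ ≤ -(a * ‖u‖ ^ 2) := by
  have hA : IsSelfAdjoint (P + Q) := hP.add hQ
  set A := P + Q with hAdef
  have hnonpos : ∀ v ∈ negSpace A, 0 ≤ ⟪(-A) v, v⟫_ℝ := fun v hv => by
    rw [neg_apply, inner_neg_left]
    exact neg_nonneg.2 (inner_nonpos_of_mem_negSpace hA hv)
  by_contra hcon
  have hseq : ∀ k : ℕ, ∃ v ∈ negSpace A, ‖v‖ = 1 ∧ ⟪(-A) v, v⟫_ℝ < 1 / ((k : ℝ) + 1) := by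
    intro k
    by_contra! hk
    refine hcon ⟨1 / ((k : ℝ) + 1), by positivity, fun u hu => ?_⟩
    have := mul_norm_sq_le_of_unit hk hu
    rw [neg_apply, inner_neg_left] at this
    linarith
  choose u huW hu1 hub using hseq
  let U : Ultrafilter ℕ := hyperfilter ℕ
  have hU : (U : Filter ℕ) ≤ atTop := Nat.hyperfilter_le_atTop
  obtain ⟨w, hw⟩ := exists_weakLimit U (fun i => (hu1 i).le)
  have hwW : w ∈ negSpace A := weakLimit_mem hw _ isClosed_negSpace huW
  have hlim := tendsto_of_weakLimit_of_nonpos hw hu1 hC hPC hQc (negSpace A)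
    (fun v hv => inner_nonpos_of_mem_negSpace hA hv) huW hwW
  have hw1 : ‖w‖ = 1 := by
    refine tendsto_nhds_unique hlim.norm ?_
    simp only [hu1]
    exact tendsto_const_nhds
  have hform : Tendsto (fun i => ⟪(-A) (u i), u i⟫_ℝ) U (𝓝 ⟪(-A) w, w⟫_ℝ) :=
    (((-A).continuous.tendsto w).comp hlim).inner hlim
  have hle : ⟪(-A) w, w⟫_ℝ ≤ 0 :=
    le_of_tendsto_of_tendsto' hform (tendsto_one_div_add_atTop_nhds_zero_nat.mono_left hU)
      fun i => (hub i).le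
  have hAw := map_eq_zero_of_isotropic hA.neg hnonpos
    (fun v hv => Submodule.neg_mem _ (map_mem_negSpace (fun _ => rfl) hv)) hwW hle
  have hnull : w ∈ nullSpace A := mem_nullSpace.2 (neg_eq_zero.1 hAw)
  have h0 : ⟪w, w⟫_ℝ = 0 := negSpace_le_nullSpace_orthogonal hA hwW w hnull
  rw [real_inner_self_eq_norm_sq, hw1] at h0
  norm_num at h0

end Coercive

/-! ### Stability of the forms near the origin -/

section Stability

variable [CompleteSpace H] {X : Type*} {l : Filter X} [l.IsCountablyGenerated]
  {P Q : X → H →L[ℝ] H} {P₀ Q₀ : H →L[ℝ] H} {C : ℝ}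

/-- Coercivity of the limiting form on a closed subspace is inherited by the nearby forms. -/
theorem exists_eventually_coercive
    (hP : ∀ v, Tendsto (fun x => P x v) l (𝓝 (P₀ v)))
    (hPs : ∀ᶠ x in l, IsSelfAdjoint (P x))
    (hC : 0 < C) (hPC : ∀ᶠ x in l, ∀ v, C * ‖v‖ ^ 2 ≤ ⟪P x v, v⟫_ℝ)
    (hQ : Tendsto Q l (𝓝 Q₀)) (hQ₀ : IsCompactOperator Q₀)
    {W : Submodule ℝ H} (hW : IsClosed (W : Set H)) {a : ℝ} (ha : 0 < a)
    (hWa : ∀ v ∈ W, a * ‖v‖ ^ 2 ≤ ⟪(P₀ + Q₀) v, v⟫_ℝ) :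
    ∃ c : ℝ, 0 < c ∧ ∀ᶠ x in l, ∀ v ∈ W, c * ‖v‖ ^ 2 ≤ ⟪(P x + Q x) v, v⟫_ℝ := by
  -- the gain `C (1 - ‖w‖²)` and `a ‖w‖²` add up to at least `min C a`, so that half of it is exceeded
  set c := min C a / 2 with hc
  have hcpos : 0 < c := by positivity
  refine ⟨c, hcpos, ?_⟩
  by_contra hcon
  have hfreq : ∃ᶠ x in l, ∃ v ∈ W, ‖v‖ = 1 ∧ ⟪(P x + Q x) v, v⟫_ℝ ≤ c := by
    refine (not_eventually.1 hcon).mono fun x hx => ?_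
    by_contra! hx'
    exact hx fun v hv => mul_norm_sq_le_of_unit (fun v hv hv1 => (hx' v hv hv1).le) hv
  obtain ⟨x, hx, hux⟩ := exists_seq_forall_of_frequently hfreq
  choose u huW hu1 hub using hux
  let U : Ultrafilter ℕ := hyperfilter ℕ
  have hU : Tendsto x U l := hx.mono_left Nat.hyperfilter_le_atTop
  obtain ⟨w, hw⟩ := exists_weakLimit U (fun i => (hu1 i).le)
  have hwW : w ∈ W := weakLimit_mem hw _ hW huW
  obtain ⟨hw1, hwle⟩ := le_of_weakLimit (P := fun i => P (x i)) (Q := fun i => Q (x i)) hw hu1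
    (fun v => (hP v).comp hU) (hU.eventually hPs) (hU.eventually hPC) (hQ.comp hU) hQ₀
    tendsto_const_nhds (Eventually.of_forall hub)
  have h1 := hWa w hwW
  have h2 : ‖w‖ ^ 2 ≤ 1 := by nlinarith [norm_nonneg w]
  have h3 : min C a ≤ C * (1 - ‖w‖ ^ 2) + a * ‖w‖ ^ 2 := by
    nlinarith [min_le_left C a, min_le_right C a, sq_nonneg ‖w‖]
  have h4 : 0 < min C a := by positivity
  linarith

/-- On a closed subspace where the limiting form is non-positive (such a subspace is
finite-dimensional), strong convergence of the operators is uniform on the unit ball. -/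
theorem eventually_norm_sub_le
    (hP : ∀ v, Tendsto (fun x => P x v) l (𝓝 (P₀ v)))
    {M : ℝ} (hM : ∀ᶠ x in l, ‖P x‖ ≤ M)
    (hC : 0 < C) (hPC : ∀ v, C * ‖v‖ ^ 2 ≤ ⟪P₀ v, v⟫_ℝ)
    (hQ : Tendsto Q l (𝓝 Q₀)) (hQ₀ : IsCompactOperator Q₀)
    {W : Submodule ℝ H} (hW : IsClosed (W : Set H))
    (hWn : ∀ v ∈ W, ⟪(P₀ + Q₀) v, v⟫_ℝ ≤ 0) {η : ℝ} (hη : 0 < η) :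
    ∀ᶠ x in l, ∀ v ∈ W, ‖(P x + Q x) v - (P₀ + Q₀) v‖ ≤ η * ‖v‖ := by
  by_contra hcon
  have hfreq : ∃ᶠ x in l, ∃ v ∈ W, ‖v‖ = 1 ∧ η ≤ ‖(P x + Q x) v - (P₀ + Q₀) v‖ := by
    refine (not_eventually.1 hcon).mono fun x hx => ?_
    by_contra! hx'
    refine hx fun v hv => ?_
    rcases eq_or_ne v 0 with rfl | hv0
    · simp
    have h1 := (hx' (‖v‖⁻¹ • v) (W.smul_mem _ hv) (norm_smul_inv_norm hv0)).le
    rw [map_smul, map_smul, ← smul_sub, norm_smul, norm_inv, norm_norm, inv_mul_eq_div,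
      div_le_iff₀ (norm_pos_iff.2 hv0)] at h1
    exact h1
  obtain ⟨x, hx, hux⟩ := exists_seq_forall_of_frequently hfreq
  choose u huW hu1 hub using hux
  let U : Ultrafilter ℕ := hyperfilter ℕ
  have hU : Tendsto x U l := hx.mono_left Nat.hyperfilter_le_atTop
  obtain ⟨w, hw⟩ := exists_weakLimit U (fun i => (hu1 i).le)
  have hwW : w ∈ W := weakLimit_mem hw _ hW huW
  have hlim := tendsto_of_weakLimit_of_nonpos hw hu1 hC hPC hQ₀ W hWn huW hwW
  have hd : Tendsto (fun i => ‖u i - w‖) U (𝓝 0) := tendsto_iff_norm_sub_tendsto_zero.1 hlim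
  have hP0 : Tendsto (fun i => P (x i) (u i)) U (𝓝 (P₀ w)) := by
    have h1 : Tendsto (fun i => P (x i) (u i - w)) U (𝓝 0) := by
      have h2 := hd.const_mul M
      rw [mul_zero] at h2
      refine squeeze_zero_norm' ?_ h2
      filter_upwards [hU.eventually hM] with i hi
      exact ((P (x i)).le_opNorm _).trans (mul_le_mul_of_nonneg_right hi (norm_nonneg _))
    have h2 := h1.add ((hP w).comp hU)
    rw [zero_add] at h2
    refine h2.congr fun i => ?_
    simp
  have hQ0 : Tendsto (fun i => Q (x i) (u i)) U (𝓝 (Q₀ w)) :=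
    ((isBoundedBilinearMap_apply (𝕜 := ℝ) (E := H) (F := H)).continuous.tendsto (Q₀, w)).comp
      ((hQ.comp hU).prodMk_nhds hlim)
  have h1 : Tendsto (fun i => ‖(P (x i) + Q (x i)) (u i) - (P₀ + Q₀) (u i)‖) U (𝓝 0) := by
    have h2 := ((hP0.add hQ0).sub (((P₀ + Q₀).continuous.tendsto w).comp hlim)).norm
    simpa using h2
  exact hη.not_ge (ge_of_tendsto' h1 hub)

end Stability

end

/-! ### The standing hypotheses near the origin -/

section

variable {H : Type*} [NormedAddCommGroup H] [InnerProductSpace ℝ H] [CompleteSpace H]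

section Hypotheses

variable {V : Set H} {L : H → ℝ} {B P Q : H → H →L[ℝ] H}

theorem SplittingHypothesis.mem_nhds (h : SplittingHypothesis V L B P Q) : V ∈ 𝓝 (0 : H) :=
  h.isOpen.mem_nhds h.zero_mem

theorem SplittingHypothesis.tendsto_P (h : SplittingHypothesis V L B P Q) (v : H) :
    Tendsto (fun x => P x v) (𝓝 0) (𝓝 (P 0 v)) := by
  rw [Metric.tendsto_nhds]
  intro η hη
  by_contra hcon
  obtain ⟨x, hx, hxp⟩ := exists_seq_forall_of_frequently
    ((not_eventually.1 hcon).and_eventually h.mem_nhds)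
  have h1 := h.D2 x (fun k => (hxp k).2) (by simpa using hx.norm) v
  obtain ⟨k, hk⟩ := (h1.eventually_lt_const hη).exists
  exact (hxp k).1 (by rwa [dist_eq_norm])

theorem SplittingHypothesis.exists_eventually_coercive_P (h : SplittingHypothesis V L B P Q) :
    ∃ C : ℝ, 0 < C ∧ ∀ᶠ x in 𝓝 (0 : H), ∀ u : H, C * ‖u‖ ^ 2 ≤ ⟪P x u, u⟫_ℝ := by
  by_contra! hcon
  have hseq : ∀ k : ℕ, ∃ x ∈ V, ‖x‖ < 1 / ((k : ℝ) + 1) ∧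
      ∃ u : H, ⟪P x u, u⟫_ℝ < 1 / ((k : ℝ) + 1) * ‖u‖ ^ 2 := by
    intro k
    have hk : (0 : ℝ) < 1 / ((k : ℝ) + 1) := by positivity
    have hfr := hcon _ hk
    obtain ⟨x, hx, hxV, hxk⟩ := (hfr.and_eventually
      (inter_mem h.mem_nhds (Metric.ball_mem_nhds 0 hk))).exists
    exact ⟨x, hxV, by simpa using hxk, hx⟩
  choose x hxV hxk hxu using hseq
  have hx0 : Tendsto (fun k => ‖x k‖) atTop (𝓝 0) :=
    squeeze_zero (fun _ => norm_nonneg _) (fun k => (hxk k).le)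
      tendsto_one_div_add_atTop_nhds_zero_nat
  obtain ⟨C, hC, k₀, hk₀⟩ := h.D4 x hxV hx0
  obtain ⟨k, hk, hkk⟩ := ((tendsto_one_div_add_atTop_nhds_zero_nat.eventually_lt_const hC).and
    (eventually_ge_atTop k₀)).exists
  obtain ⟨u, hu⟩ := hxu k
  have h1 := hk₀ k hkk u
  have h2 : 1 / ((k : ℝ) + 1) * ‖u‖ ^ 2 ≤ C * ‖u‖ ^ 2 :=
    mul_le_mul_of_nonneg_right hk.le (by positivity)
  linarith

/-- By the uniform boundedness principle, `P` is bounded near the origin. -/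
theorem SplittingHypothesis.exists_eventually_norm_P_le (h : SplittingHypothesis V L B P Q) :
    ∃ M : ℝ, ∀ᶠ x in 𝓝 (0 : H), ‖P x‖ ≤ M := by
  by_contra! hcon
  have hseq : ∀ k : ℕ, ∃ x : H, ‖x‖ < 1 / ((k : ℝ) + 1) ∧ (k : ℝ) < ‖P x‖ := by
    intro k
    have hk : (0 : ℝ) < 1 / ((k : ℝ) + 1) := by positivity
    obtain ⟨x, hx, hxk⟩ := ((hcon k).and_eventually (Metric.ball_mem_nhds (0 : H) hk)).exists
    exact ⟨x, by simpa using hxk, hx⟩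
  choose x hxk hxP using hseq
  have hx0 : Tendsto x atTop (𝓝 0) :=
    squeeze_zero_norm (fun k => (hxk k).le) tendsto_one_div_add_atTop_nhds_zero_nat
  obtain ⟨M, hM⟩ := banach_steinhaus (g := fun k => P (x k)) fun v => by
    obtain ⟨M, hM⟩ := ((h.tendsto_P v).comp hx0).norm.bddAbove_range
    exact ⟨M, fun k => hM ⟨k, rfl⟩⟩
  obtain ⟨k, hk⟩ := exists_nat_gt M
  linarith [hM k, hxP k]

theorem SplittingHypothesis.tendsto_Q (h : SplittingHypothesis V L B P Q) :
    Tendsto Q (𝓝 0) (𝓝 (Q 0)) :=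
  (h.D3.continuousAt h.mem_nhds).tendsto

end Hypotheses

/-- The operator `D` is close to `A` in the sense needed below: its form is at least `c` on the
positive space and at most `-c` on the negative space of `A`, its norm is at most `M`, and it is
at most `2 * c` on the null space of `A`. -/
structure IsNearby (A D : H →L[ℝ] H) (c M : ℝ) : Prop where
  selfAdjoint : IsSelfAdjoint D
  pos : ∀ v ∈ posSpace A, c * ‖v‖ ^ 2 ≤ ⟪D v, v⟫_ℝ
  neg : ∀ v ∈ negSpace A, ⟪D v, v⟫_ℝ ≤ -(c * ‖v‖ ^ 2)
  norm_le : ‖D‖ ≤ M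
  null : ∀ v ∈ nullSpace A, ‖D v‖ ≤ 2 * c * ‖v‖

theorem IsNearby.add {A D E : H →L[ℝ] H} {c M : ℝ} (hD : IsNearby A D (2 * c) M)
    (hnull : ∀ v ∈ nullSpace A, ‖D v‖ ≤ c * ‖v‖) (hE : IsSelfAdjoint E) (hEc : ‖E‖ ≤ c) :
    IsNearby A (D + E) c (M + c) := by
  have h1 : ∀ v, ‖E v‖ ≤ c * ‖v‖ := fun v =>
    (E.le_opNorm v).trans (mul_le_mul_of_nonneg_right hEc (norm_nonneg v))
  have h2 : ∀ v, |⟪E v, v⟫_ℝ| ≤ c * ‖v‖ ^ 2 := fun v =>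
    (abs_real_inner_le_norm _ _).trans (by nlinarith [h1 v, norm_nonneg v])
  refine ⟨hD.selfAdjoint.add hE, fun v hv => ?_, fun v hv => ?_,
    (norm_add_le _ _).trans (add_le_add hD.norm_le hEc), fun v hv => ?_⟩
  · have h3 := hD.pos v hv
    have h4 := (abs_le.1 (h2 v)).1
    rw [add_apply, inner_add_left]
    linarith
  · have h3 := hD.neg v hv
    have h4 := (abs_le.1 (h2 v)).2
    rw [add_apply, inner_add_left]
    linarith
  · have h3 := hnull v hv
    have h4 := h1 v
    rw [add_apply]
    exact (norm_add_le _ _).trans (by linarith)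

section Hypotheses

variable {V : Set H} {L : H → ℝ} {B P Q : H → H →L[ℝ] H}

theorem SplittingHypothesis.exists_eventually_isNearby (h : SplittingHypothesis V L B P Q) :
    ∃ c M : ℝ, 0 < c ∧ ∀ᶠ x in 𝓝 (0 : H), IsNearby (B 0) (B x) (2 * c) M ∧
      ∀ v ∈ nullSpace (B 0), ‖B x v‖ ≤ c * ‖v‖ := by
  have hV := h.mem_nhds
  have hB0 : B 0 = P 0 + Q 0 := h.decomp 0 h.zero_mem
  have hA : IsSelfAdjoint (B 0) := h.selfAdjoint_B 0 h.zero_mem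
  obtain ⟨C, hC, hPC⟩ := h.exists_eventually_coercive_P
  obtain ⟨M, hM⟩ := h.exists_eventually_norm_P_le
  have hPC0 := hPC.self_of_nhds
  have hQc := h.compact_Q 0 h.zero_mem
  have hPs : ∀ᶠ x in 𝓝 (0 : H), IsSelfAdjoint (P x) :=
    Filter.mem_of_superset hV h.selfAdjoint_P
  obtain ⟨a, ha, hpos⟩ := exists_coercive_posSpace (h.selfAdjoint_P 0 h.zero_mem)
    (h.selfAdjoint_Q 0 h.zero_mem) hC hPC0 hQc
  obtain ⟨b, hb, hneg⟩ := exists_coercive_negSpace (h.selfAdjoint_P 0 h.zero_mem)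
    (h.selfAdjoint_Q 0 h.zero_mem) hC hPC0 hQc
  obtain ⟨a', ha', hpos'⟩ := exists_eventually_coercive h.tendsto_P hPs hC hPC h.tendsto_Q hQc
    (isClosed_posSpace (A := P 0 + Q 0)) ha hpos
  -- `B x` keeps half of the bound `b` on the negative space, and half of each bound is left over for
  -- a perturbation of norm at most `c`
  set c := min a' (b / 2) / 2 with hc
  have hcpos : 0 < c := by positivity
  have hca : 2 * c ≤ a' := by rw [hc]; linarith [min_le_left a' (b / 2)]
  have hcb : 4 * c ≤ b := by rw [hc]; linarith [min_le_right a' (b / 2)]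
  have hneg' := eventually_norm_sub_le h.tendsto_P hM hC hPC0 h.tendsto_Q hQc
    (isClosed_negSpace (A := P 0 + Q 0))
    (fun v hv => inner_nonpos_of_mem_negSpace (hB0 ▸ hA) hv) (half_pos hb)
  have hnull' := eventually_norm_sub_le h.tendsto_P hM hC hPC0 h.tendsto_Q hQc
    (isClosed_nullSpace (A := P 0 + Q 0))
    (fun v hv => by rw [mem_nullSpace.1 hv, inner_zero_left]) hcpos
  have hQM : ∀ᶠ x in 𝓝 (0 : H), ‖Q x‖ ≤ ‖Q 0‖ + 1 :=
    h.tendsto_Q.norm.eventually_le_const (lt_add_one _)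
  refine ⟨c, M + (‖Q 0‖ + 1), hcpos, ?_⟩
  filter_upwards [hV, hpos', hneg', hnull', hM, hQM] with x hxV hx1 hx2 hx3 hx4 hx5
  have hnull : ∀ v ∈ nullSpace (B 0), ‖B x v‖ ≤ c * ‖v‖ := by
    intro v hv
    have h1 := hx3 v (hB0 ▸ hv)
    rwa [← hB0, mem_nullSpace.1 hv, sub_zero, ← h.decomp x hxV] at h1
  refine ⟨⟨h.selfAdjoint_B x hxV, fun v hv => ?_, fun v hv => ?_, ?_, fun v hv => ?_⟩, hnull⟩
  · rw [h.decomp x hxV]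
    refine le_trans ?_ (hx1 v (hB0 ▸ hv))
    gcongr
  · have h1 := hx2 v (hB0 ▸ hv)
    have h2 := hneg v (hB0 ▸ hv)
    rw [← h.decomp x hxV, ← hB0] at h1
    rw [← hB0] at h2
    have h3 := (abs_le.1 (abs_real_inner_le_norm (B x v - B 0 v) v)).2
    rw [inner_sub_left] at h3
    have h4 := mul_le_mul_of_nonneg_right h1 (norm_nonneg v)
    nlinarith [sq_nonneg ‖v‖]
  · rw [h.decomp x hxV]
    exact (norm_add_le _ _).trans (add_le_add hx4 hx5)
  · refine (hnull v hv).trans ?_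
    have := mul_nonneg hcpos.le (norm_nonneg v)
    linarith

/-- The Hessians of the perturbed functional `L + ∑ⱼ λⱼ Gⱼ` are near `B 0`, uniformly for small
`λ` and near the origin. -/
theorem SplittingHypothesis.exists_isNearby (h : SplittingHypothesis V L B P Q)
    {n : ℕ} {G : Fin n → H → ℝ} {G'' : Fin n → H → H →L[ℝ] H}
    (hG : ∀ j, PerturbationHypothesis V (G j) (G'' j)) :
    ∃ R δ c M : ℝ, 0 < R ∧ 0 < δ ∧ 0 < c ∧ c ≤ M ∧ Metric.ball (0 : H) R ⊆ V ∧
      ∀ m : Fin n → ℝ, (∀ j, |m j| ≤ δ) → ∀ x ∈ Metric.ball (0 : H) R,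
        IsNearby (B 0) (B x + ∑ j, m j • G'' j x) c M := by
  obtain ⟨c, M, hc, hB⟩ := h.exists_eventually_isNearby
  have hG1 : ∀ᶠ x in 𝓝 (0 : H), ∀ j, ‖G'' j x‖ ≤ ‖G'' j 0‖ + 1 :=
    eventually_all.2 fun j => (((hG j).continuousAt.continuousAt
      h.mem_nhds).tendsto.norm).eventually_le_const (lt_add_one _)
  obtain ⟨R, hR, hball⟩ := Metric.eventually_nhds_iff_ball.1 ((hB.and hG1).and h.mem_nhds)
  set K : ℝ := ∑ j, (‖G'' j 0‖ + 1) with hK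
  have hK0 : 0 ≤ K := Finset.sum_nonneg fun j _ => by positivity
  refine ⟨R, c / (K + 1), c, M + c, hR, by positivity, hc, ?_, fun x hx => (hball x hx).2,
    fun m hm x hx => ?_⟩
  · have := (norm_nonneg _).trans (hB.self_of_nhds).1.norm_le
    linarith
  · obtain ⟨⟨⟨hx1, hx2⟩, hx3⟩, hxV⟩ := hball x hx
    refine hx1.add hx2 ?_ ?_
    · exact isSelfAdjoint_sum _ fun j _ => (IsSelfAdjoint.all (m j)).smul ((hG j).selfAdjoint x hxV)
    · calc ‖∑ j, m j • G'' j x‖ ≤ ∑ j, c / (K + 1) * (‖G'' j 0‖ + 1) := by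
            refine norm_sum_le_of_le _ fun j _ => ?_
            rw [norm_smul]
            exact mul_le_mul (hm j) (hx3 j) (norm_nonneg _) (by positivity)
        _ = c * (K / (K + 1)) := by rw [← Finset.mul_sum]; ring
        _ ≤ c := mul_le_of_le_one_right hc.le ((div_le_one (by positivity)).2 (by linarith))

end Hypotheses

/-! ### The gradient field of the perturbed functional -/

/-- The gradient `∇L + ∑ⱼ λⱼ ∇Gⱼ` of the perturbed functional. -/
noncomputable def gradField (L : H → ℝ) {n : ℕ} (G : Fin n → H → ℝ) (m : Fin n → ℝ) (x : H) : H :=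
  gradient L x + ∑ j, m j • gradient (G j) x

theorem continuousOn_gradient {V : Set H} (hV : IsOpen V) {f : H → ℝ} (hf : ContDiffOn ℝ 1 f V) :
    ContinuousOn (gradient f) V :=
  (InnerProductSpace.toDual ℝ H).symm.continuous.comp_continuousOn
    (hf.continuousOn_fderiv_of_isOpen hV le_rfl)

theorem gradient_eq_zero {f : H → ℝ} {x : H} (hf : fderiv ℝ f x = 0) : gradient f x = 0 := by
  rw [gradient, hf, map_zero]

section GradField

variable {V : Set H} {L : H → ℝ} {B P Q : H → H →L[ℝ] H}
  {n : ℕ} {G : Fin n → H → ℝ} {G'' : Fin n → H → H →L[ℝ] H}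

theorem continuousOn_gradField (h : SplittingHypothesis V L B P Q)
    (hG : ∀ j, PerturbationHypothesis V (G j) (G'' j)) :
    ContinuousOn (fun q : (Fin n → ℝ) × H => gradField L G q.1 q.2) (Set.univ ×ˢ V) := by
  have hsnd : Set.MapsTo Prod.snd ((Set.univ : Set (Fin n → ℝ)) ×ˢ V) V := fun q hq => hq.2
  refine ((continuousOn_gradient h.isOpen h.contDiffOn).comp continuousOn_snd hsnd).add
    (continuousOn_finsetSum _ fun j _ => ?_)
  exact (by fun_prop : ContinuousOn (fun q : (Fin n → ℝ) × H => q.1 j) _).smul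
    ((continuousOn_gradient h.isOpen (hG j).contDiffOn).comp continuousOn_snd hsnd)

theorem tendsto_gradField_add (h : SplittingHypothesis V L B P Q)
    (hG : ∀ j, PerturbationHypothesis V (G j) (G'' j)) {m : Fin n → ℝ} {z v : H}
    (hzv : z + v ∈ V) :
    Tendsto (fun q : (Fin n → ℝ) × H => gradField L G q.1 (q.2 + v)) (𝓝 (m, z))
      (𝓝 (gradField L G m (z + v))) := by
  have h1 : ContinuousAt (fun q : (Fin n → ℝ) × H => gradField L G q.1 q.2) (m, z + v) :=
    (continuousOn_gradField h hG).continuousAt (prod_mem_nhds univ_mem (h.isOpen.mem_nhds hzv))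
  have h2 : ContinuousAt (fun q : (Fin n → ℝ) × H => (q.1, q.2 + v)) (m, z) := by fun_prop
  exact ContinuousAt.comp (f := fun q : (Fin n → ℝ) × H => (q.1, q.2 + v)) h1 h2

theorem gradField_zero (h : SplittingHypothesis V L B P Q)
    (hG : ∀ j, PerturbationHypothesis V (G j) (G'' j)) (m : Fin n → ℝ) :
    gradField L G m 0 = 0 := by
  simp [gradField, gradient_eq_zero h.critical, fun j => gradient_eq_zero (hG j).critical]

theorem hasGateauxDerivAt_gradField (h : SplittingHypothesis V L B P Q)
    (hG : ∀ j, PerturbationHypothesis V (G j) (G'' j)) (m : Fin n → ℝ) {x : H} (hx : x ∈ V) :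
    HasGateauxDerivAt (gradField L G m) (B x + ∑ j, m j • G'' j x) x := by
  intro v
  have h1 : HasDerivAt (fun t : ℝ => gradient L (x + t • v)) (B x v) 0 := h.gateaux x hx v
  have h2 : ∀ j ∈ Finset.univ, HasDerivAt (fun t : ℝ => m j • gradient (G j) (x + t • v))
      (m j • G'' j x v) 0 := fun j _ => HasDerivAt.const_smul (m j) ((hG j).gateaux x hx v)
  have h3 := h1.add (HasDerivAt.fun_sum h2)
  simp only [add_apply, sum_apply, smul_apply]
  exact h3

end GradField

end

/-! ### The sign flip and the projection off the null space -/

section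

variable {H : Type*} [NormedAddCommGroup H] [InnerProductSpace ℝ H] [CompleteSpace H]
  {A : H →L[ℝ] H}

/-- The isometric involution of `H` that is `-1` on the negative space of `A` and `1` on its
orthogonal complement. -/
noncomputable def signFlip (A : H →L[ℝ] H) : H ≃ₗᵢ[ℝ] H := (negSpace A)ᗮ.reflection

theorem signFlip_signFlip (u : H) : signFlip A (signFlip A u) = u :=
  (negSpace A)ᗮ.reflection_reflection u

theorem inner_signFlip_left (u v : H) : ⟪signFlip A u, v⟫_ℝ = ⟪u, signFlip A v⟫_ℝ := by
  rw [← (signFlip A).inner_map_map (signFlip A u) v, signFlip_signFlip]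

theorem signFlip_eq (u : H) : signFlip A u = u - (2 : ℝ) • (negSpace A).starProjection u := by
  have h := (negSpace A).starProjection_add_starProjection_orthogonal u
  rw [signFlip, Submodule.reflection_apply, eq_sub_iff_add_eq'.2 h, two_smul, two_smul]
  abel

/-- An element of the orthogonal complement of the null space splits into its components in the
positive and the negative space. -/
theorem exists_add_of_mem_orthogonal (hA : IsSelfAdjoint A) {u : H} (hu : u ∈ (nullSpace A)ᗮ) :
    ∃ p ∈ posSpace A, ∃ m ∈ negSpace A, u = p + m ∧ signFlip A u = p - m ∧ ⟪p, m⟫_ℝ = 0 := by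
  have hm : (negSpace A).starProjection u ∈ negSpace A := Submodule.starProjection_apply_mem _ _
  have hp : u - (negSpace A).starProjection u ∈ (negSpace A)ᗮ :=
    Submodule.sub_starProjection_mem_orthogonal _
  refine ⟨u - (negSpace A).starProjection u, mem_posSpace_of_inf ?_ hp,
    (negSpace A).starProjection u, hm, by abel, ?_, ?_⟩
  · exact Submodule.sub_mem _ hu (negSpace_le_nullSpace_orthogonal hA hm)
  · rw [signFlip_eq, two_smul]
    abel
  · exact (Submodule.mem_orthogonal' _ _).1 hp _ hm

theorem signFlip_mem (hA : IsSelfAdjoint A) {u : H} (hu : u ∈ (nullSpace A)ᗮ) :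
    signFlip A u ∈ (nullSpace A)ᗮ := by
  obtain ⟨p, hp, m, hm, -, h, -⟩ := exists_add_of_mem_orthogonal hA hu
  rw [h]
  exact Submodule.sub_mem _ (posSpace_le_nullSpace_orthogonal hp)
    (negSpace_le_nullSpace_orthogonal hA hm)

theorem perpProj_mem (v : H) : perpProj A v ∈ (nullSpace A)ᗮ :=
  Submodule.sub_starProjection_mem_orthogonal v

theorem inner_perpProj_left (v : H) {w : H} (hw : w ∈ (nullSpace A)ᗮ) :
    ⟪perpProj A v, w⟫_ℝ = ⟪v, w⟫_ℝ := by
  have h : ⟪(nullSpace A).starProjection v, w⟫_ℝ = 0 :=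
    hw _ (Submodule.starProjection_apply_mem _ _)
  simp [perpProj, inner_sub_left, h]

omit [CompleteSpace H] in
theorem mem_paramDomain {n : ℕ} {δ ε : ℝ} {m : Fin n → ℝ} {z : H} :
    (m, z) ∈ paramDomain A n δ ε ↔ (∀ j, |m j| ≤ δ) ∧ ‖z‖ < ε ∧ z ∈ nullSpace A := by
  simp [paramDomain, abs_le, Set.mem_pi, -Set.pi_univ_Icc]

theorem norm_perpProj_le (v : H) : ‖perpProj A v‖ ≤ ‖v‖ := by
  have h1 := inner_perpProj_left v (perpProj_mem (A := A) v)
  rw [real_inner_self_eq_norm_sq] at h1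
  have h2 := real_inner_le_norm v (perpProj A v)
  by_contra! h3
  nlinarith [norm_nonneg v]

omit [CompleteSpace H] in
theorem norm_lt_of_mem_Qset {r s : ℝ} {u : H} (hu : u ∈ Qset A r s) : ‖u‖ < r + s := by
  obtain ⟨p, -, m, -, hp, hm, rfl⟩ := hu
  exact (norm_add_le _ _).trans_lt (add_lt_add hp hm)

theorem Qset_subset_orthogonal (hA : IsSelfAdjoint A) (r s : ℝ) :
    Qset A r s ⊆ ((nullSpace A)ᗮ : Set H) := by
  rintro _ ⟨p, hp, m, hm, -, -, rfl⟩
  exact Submodule.add_mem _ (posSpace_le_nullSpace_orthogonal hp)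
    (negSpace_le_nullSpace_orthogonal hA hm)

theorem mem_Qset_of_norm_lt (hA : IsSelfAdjoint A) {t : ℝ} {u : H} (hu : u ∈ (nullSpace A)ᗮ)
    (ht : ‖u‖ < t) : u ∈ Qset A t t := by
  obtain ⟨p, hp, m, hm, rfl, -, hpm⟩ := exists_add_of_mem_orthogonal hA hu
  have h := norm_add_sq_eq_norm_sq_add_norm_sq_of_inner_eq_zero p m hpm
  have h0 := norm_nonneg (p + m)
  exact ⟨p, hp, m, hm, by nlinarith [norm_nonneg p], by nlinarith [norm_nonneg m], rfl⟩

/-- After the sign flip the form of `D` is coercive on the whole complement of the null space: the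
cross terms between the positive and the negative space cancel as `D` is self-adjoint. -/
theorem IsNearby.le_inner_signFlip (hA : IsSelfAdjoint A) {D : H →L[ℝ] H} {c M : ℝ}
    (hD : IsNearby A D c M) {w : H} (hw : w ∈ (nullSpace A)ᗮ) :
    c * ‖w‖ ^ 2 ≤ ⟪D w, signFlip A w⟫_ℝ := by
  obtain ⟨p, hp, m, hm, hw, hS, hpm⟩ := exists_add_of_mem_orthogonal hA hw
  have h := norm_add_sq_eq_norm_sq_add_norm_sq_of_inner_eq_zero p m hpm
  have h1 := hD.pos p hp
  have h2 := hD.neg m hm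
  have h3 : ⟪D p, m⟫_ℝ = ⟪D m, p⟫_ℝ := by
    rw [inner_map_eq hD.selfAdjoint, real_inner_comm]
  rw [hS, hw, map_add, inner_add_left, inner_sub_right, inner_sub_right, h3, sq, h]
  linarith

/-! ### Monotone fields with a Gâteaux derivative -/

omit [CompleteSpace H] in
/-- The mean value theorem along a segment, tested against a vector. -/
theorem exists_inner_sub_eq {f : H → H} {D : H → H →L[ℝ] H} {s : Set H} (hs : Convex ℝ s)
    (hf : ∀ x ∈ s, HasGateauxDerivAt f (D x) x) {x y : H} (hx : x ∈ s) (hy : y ∈ s) (v : H) :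
    ∃ ξ ∈ s, ⟪f x - f y, v⟫_ℝ = ⟪D ξ (x - y), v⟫_ℝ := by
  have hmem : ∀ t ∈ Set.Icc (0 : ℝ) 1, y + t • (x - y) ∈ s := fun t ht =>
    hs.add_smul_sub_mem hy hx ht
  have hd : ∀ t ∈ Set.Icc (0 : ℝ) 1, HasDerivAt (fun t : ℝ => ⟪f (y + t • (x - y)), v⟫_ℝ)
      ⟪D (y + t • (x - y)) (x - y), v⟫_ℝ t := by
    intro t ht
    have h1 : HasDerivAt (fun τ : ℝ => f (y + t • (x - y) + τ • (x - y)))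
        (D (y + t • (x - y)) (x - y)) (t - t) := by
      rw [sub_self]
      exact hf _ (hmem t ht) (x - y)
    have h2 := h1.comp_sub_const t t
    have h3 : (fun τ : ℝ => f (y + t • (x - y) + (τ - t) • (x - y))) =
        fun τ : ℝ => f (y + τ • (x - y)) := by
      funext τ
      rw [add_assoc, ← add_smul, add_sub_cancel]
    rw [h3] at h2
    simpa using h2.inner ℝ (hasDerivAt_const t v)
  obtain ⟨t, ht, h⟩ := exists_hasDerivAt_eq_slope _ _ zero_lt_one
    (fun t ht => (hd t ht).continuousAt.continuousWithinAt)
    fun t ht => hd t (Set.Ioo_subset_Icc_self ht)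
  refine ⟨_, hmem t (Set.Ioo_subset_Icc_self ht), ?_⟩
  rw [h]
  simp [inner_sub_left]

omit [CompleteSpace H] in
theorem norm_sub_le_of_gateaux {f : H → H} {D : H → H →L[ℝ] H} {s : Set H} (hs : Convex ℝ s)
    (hf : ∀ x ∈ s, HasGateauxDerivAt f (D x) x) {x y : H} (hx : x ∈ s) (hy : y ∈ s) {K : ℝ}
    (hK : ∀ ξ ∈ s, ‖D ξ (x - y)‖ ≤ K) : ‖f x - f y‖ ≤ K := by
  obtain ⟨ξ, hξ, h⟩ := exists_inner_sub_eq hs hf hx hy (f x - f y)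
  rw [real_inner_self_eq_norm_sq] at h
  have h1 := real_inner_le_norm (D ξ (x - y)) (f x - f y)
  have h2 := mul_le_mul_of_nonneg_right (hK ξ hξ) (norm_nonneg (f x - f y))
  by_contra! h3
  have h4 := (norm_nonneg _).trans (hK ξ hξ)
  nlinarith

section Field

variable {f : H → H} {D : H → H →L[ℝ] H} {R c M : ℝ}

theorem le_inner_sub_signFlip (hA : IsSelfAdjoint A)
    (hf : ∀ x ∈ Metric.ball (0 : H) R, HasGateauxDerivAt f (D x) x)
    (hD : ∀ x ∈ Metric.ball (0 : H) R, IsNearby A (D x) c M) {z u v : H}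
    (hu : u ∈ (nullSpace A)ᗮ) (hv : v ∈ (nullSpace A)ᗮ)
    (hzu : z + u ∈ Metric.ball (0 : H) R) (hzv : z + v ∈ Metric.ball (0 : H) R) :
    c * ‖u - v‖ ^ 2 ≤ ⟪f (z + u) - f (z + v), signFlip A (u - v)⟫_ℝ := by
  obtain ⟨ξ, hξ, h⟩ := exists_inner_sub_eq (convex_ball _ _) hf hzu hzv (signFlip A (u - v))
  rw [h, add_sub_add_left_eq_sub]
  exact (hD ξ hξ).le_inner_signFlip hA (Submodule.sub_mem _ hu hv)

/-- Two solutions `u`, `v` of the projected equation, for the fields `f` and `f'` and the base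
points `z` and `z'`, differ by at most a multiple of the difference of the fields at `v`. -/
theorem mul_norm_sub_le (hA : IsSelfAdjoint A)
    (hf : ∀ x ∈ Metric.ball (0 : H) R, HasGateauxDerivAt f (D x) x)
    (hD : ∀ x ∈ Metric.ball (0 : H) R, IsNearby A (D x) c M) (f' : H → H) {z z' u v : H}
    (hu : u ∈ (nullSpace A)ᗮ) (hv : v ∈ (nullSpace A)ᗮ)
    (hzu : z + u ∈ Metric.ball (0 : H) R) (hzv : z + v ∈ Metric.ball (0 : H) R)
    (hu0 : perpProj A (f (z + u)) = 0) (hv0 : perpProj A (f' (z' + v)) = 0) :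
    c * ‖u - v‖ ≤ ‖f (z + v) - f' (z' + v)‖ := by
  have h1 := le_inner_sub_signFlip hA hf hD hu hv hzu hzv
  have hS := signFlip_mem hA (Submodule.sub_mem _ hu hv)
  have h2 := inner_perpProj_left (f (z + u)) hS
  have h3 := inner_perpProj_left (f' (z' + v)) hS
  rw [hu0, inner_zero_left] at h2
  rw [hv0, inner_zero_left] at h3
  have h4 := abs_real_inner_le_norm (f (z + v) - f' (z' + v)) (signFlip A (u - v))
  have h5 := (abs_le.1 h4).1
  rw [LinearIsometryEquiv.norm_map] at h5
  rw [inner_sub_left] at h1 h5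
  rcases (norm_nonneg (u - v)).eq_or_lt with h | h
  · rw [← h, mul_zero]
    exact norm_nonneg _
  · refine le_of_mul_le_mul_right ?_ h
    nlinarith

/-- Along the null space of `A` the field has Lipschitz constant `2 * c`. -/
theorem norm_sub_le_of_sub_mem_nullSpace
    (hf : ∀ x ∈ Metric.ball (0 : H) R, HasGateauxDerivAt f (D x) x)
    (hD : ∀ x ∈ Metric.ball (0 : H) R, IsNearby A (D x) c M) {x y : H}
    (hx : x ∈ Metric.ball (0 : H) R) (hy : y ∈ Metric.ball (0 : H) R)
    (hxy : x - y ∈ nullSpace A) : ‖f x - f y‖ ≤ 2 * c * ‖x - y‖ :=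
  norm_sub_le_of_gateaux (convex_ball _ _) hf hx hy fun ξ hξ => (hD ξ hξ).null _ hxy

/-- Solvability of the projected equation: with the step `c / M²`, the map
`u ↦ u - (c / M²) S P^⊥ f (z + u)`, where `S` is the sign flip, contracts a ball in the
complement of the null space. -/
theorem exists_perpProj_eq_zero (hA : IsSelfAdjoint A)
    (hf : ∀ x ∈ Metric.ball (0 : H) R, HasGateauxDerivAt f (D x) x)
    (hD : ∀ x ∈ Metric.ball (0 : H) R, IsNearby A (D x) c M) (hc : 0 < c) (hcM : c ≤ M)
    (hf0 : f 0 = 0) {t : ℝ} (ht : 0 < t) {z : H} (hzR : ‖z‖ + t < R)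
    (hz : ‖z‖ ≤ c * t / (2 * M)) :
    ∃ u ∈ (nullSpace A)ᗮ, ‖u‖ ≤ t ∧ perpProj A (f (z + u)) = 0 := by
  have hM : 0 < M := hc.trans_le hcM
  set τ : ℝ := c / M ^ 2 with hτ
  have hτ0 : 0 < τ := by positivity
  set κ : ℝ := 1 - c ^ 2 / (2 * M ^ 2) with hκ
  have hτM : τ * M ^ 2 = c := div_mul_cancel₀ _ (by positivity)
  have hκτ : κ = 1 - τ * c / 2 := by rw [hκ, hτ]; ring
  have hτc : τ * c ≤ 1 := by
    rw [hτ, div_mul_eq_mul_div, div_le_one (by positivity), ← sq]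
    exact pow_le_pow_left₀ hc.le hcM 2
  have hτc0 : 0 < τ * c := by positivity
  have hκ0 : 0 ≤ κ := by linarith
  have hκ1 : κ < 1 := by linarith
  let X : Submodule ℝ H := (nullSpace A)ᗮ
  let s : Set H := (X : Set H) ∩ Metric.closedBall 0 t
  have hball : ∀ u ∈ s, z + u ∈ Metric.ball (0 : H) R := by
    intro u hu
    have h1 : ‖u‖ ≤ t := by simpa using hu.2
    rw [mem_ball_zero_iff]
    exact (norm_add_le _ _).trans_lt (by linarith)
  let Φ : H → H := fun u => u - τ • signFlip A (perpProj A (f (z + u)))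
  have hΦX : ∀ u ∈ X, Φ u ∈ X := fun u hu =>
    X.sub_mem hu (X.smul_mem _ (signFlip_mem hA (perpProj_mem _)))
  have hlip : ∀ x ∈ Metric.ball (0 : H) R, ∀ y ∈ Metric.ball (0 : H) R,
      ‖f x - f y‖ ≤ M * ‖x - y‖ := fun x hx y hy =>
    norm_sub_le_of_gateaux (convex_ball _ _) hf hx hy fun ξ hξ =>
      ((D ξ).le_opNorm _).trans (mul_le_mul_of_nonneg_right (hD ξ hξ).norm_le (norm_nonneg _))
  have hcontr : ∀ u ∈ s, ∀ v ∈ s, ‖Φ u - Φ v‖ ≤ κ * ‖u - v‖ := by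
    intro u hu v hv
    have h1 := le_inner_sub_signFlip hA hf hD hu.1 hv.1 (hball u hu) (hball v hv)
    have h2 := hlip _ (hball u hu) _ (hball v hv)
    rw [add_sub_add_left_eq_sub] at h2
    set g := f (z + u) - f (z + v) with hg
    have h3 : Φ u - Φ v = (u - v) - τ • signFlip A (perpProj A g) := by
      simp only [Φ, hg, map_sub, smul_sub]
      abel
    have h4 : ⟪u - v, signFlip A (perpProj A g)⟫_ℝ = ⟪g, signFlip A (u - v)⟫_ℝ := by
      rw [← inner_signFlip_left, real_inner_comm,
        inner_perpProj_left _ (signFlip_mem hA (X.sub_mem hu.1 hv.1))]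
    have h5 : ‖signFlip A (perpProj A g)‖ ≤ M * ‖u - v‖ := by
      rw [LinearIsometryEquiv.norm_map]
      exact (norm_perpProj_le _).trans h2
    have h6 : ‖Φ u - Φ v‖ ^ 2 ≤ (κ * ‖u - v‖) ^ 2 := by
      rw [h3, norm_sub_sq_real, real_inner_smul_right, h4, norm_smul, Real.norm_of_nonneg hτ0.le]
      have h7 : ‖signFlip A (perpProj A g)‖ ^ 2 ≤ (M * ‖u - v‖) ^ 2 :=
        pow_le_pow_left₀ (norm_nonneg _) h5 2
      calc ‖u - v‖ ^ 2 - 2 * (τ * ⟪g, signFlip A (u - v)⟫_ℝ) +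
              (τ * ‖signFlip A (perpProj A g)‖) ^ 2
          ≤ ‖u - v‖ ^ 2 - 2 * (τ * (c * ‖u - v‖ ^ 2)) + τ ^ 2 * (M * ‖u - v‖) ^ 2 := by
            rw [mul_pow]
            gcongr
        _ = (1 - 2 * (τ * c) + τ * (τ * M ^ 2)) * ‖u - v‖ ^ 2 := by ring
        _ ≤ κ ^ 2 * ‖u - v‖ ^ 2 := by
            rw [hτM, hκτ]
            refine mul_le_mul_of_nonneg_right ?_ (sq_nonneg _)
            nlinarith [sq_nonneg (τ * c)]
        _ = (κ * ‖u - v‖) ^ 2 := by ring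
    exact le_of_sq_le_sq h6 (by positivity)
  have h0s : (0 : H) ∈ s := ⟨X.zero_mem, by simpa using ht.le⟩
  -- the hypothesis on `‖z‖` says that `Φ` moves the centre by at most `(1 - κ) t`
  have hΦ0 : ‖Φ 0‖ ≤ (1 - κ) * t := by
    have h0R : (0 : H) ∈ Metric.ball (0 : H) R := by
      rw [mem_ball_zero_iff, norm_zero]
      linarith [norm_nonneg z]
    have h1 := hlip _ (hball 0 h0s) _ h0R
    rw [add_zero, hf0, sub_zero, sub_zero] at h1
    have h2 : ‖Φ 0‖ ≤ τ * (M * ‖z‖) := by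
      simp only [Φ, zero_sub, norm_neg, norm_smul, LinearIsometryEquiv.norm_map, add_zero,
        Real.norm_of_nonneg hτ0.le]
      exact mul_le_mul_of_nonneg_left ((norm_perpProj_le _).trans h1) hτ0.le
    refine h2.trans ?_
    calc τ * (M * ‖z‖) ≤ τ * (M * (c * t / (2 * M))) := by gcongr
      _ = (1 - κ) * t := by rw [hκτ]; field_simp; ring
  have hmaps : Set.MapsTo Φ s s := by
    intro u hu
    refine ⟨hΦX u hu.1, ?_⟩
    have h1 := hcontr u hu 0 h0s
    have h2 : ‖u‖ ≤ t := by simpa using hu.2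
    rw [sub_zero] at h1
    rw [mem_closedBall_zero_iff]
    calc ‖Φ u‖ = ‖(Φ u - Φ 0) + Φ 0‖ := by rw [sub_add_cancel]
      _ ≤ κ * ‖u‖ + (1 - κ) * t := (norm_add_le _ _).trans (add_le_add h1 hΦ0)
      _ ≤ κ * t + (1 - κ) * t := by gcongr
      _ = t := by ring
  have hcomplete : IsComplete s :=
    ((Submodule.isClosed_orthogonal _).inter Metric.isClosed_closedBall).isComplete
  have hcw : ContractingWith ⟨κ, hκ0⟩ (hmaps.restrict Φ s s) := by
    refine ⟨hκ1, LipschitzWith.of_dist_le_mul fun u v => ?_⟩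
    rw [Subtype.dist_eq, Subtype.dist_eq, dist_eq_norm, dist_eq_norm]
    exact hcontr u u.2 v v.2
  obtain ⟨u, hu, hfix, -⟩ := hcw.exists_fixedPoint' hcomplete hmaps h0s (edist_ne_top _ _)
  refine ⟨u, hu.1, by simpa using hu.2, ?_⟩
  have h1 : τ • signFlip A (perpProj A (f (z + u))) = 0 := sub_eq_self.1 hfix
  have h2 := (smul_eq_zero.1 h1).resolve_left hτ0.ne'
  exact (map_eq_zero_iff _ (signFlip A).injective).1 h2

end Field

/-! ### Symmetries -/

theorem gradient_comp_isometry {V : Set H} (hV : IsOpen V) {f : H → ℝ}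
    (hf : DifferentiableOn ℝ f V) (T : H ≃ₗᵢ[ℝ] H) (hTV : ∀ x ∈ V, T x ∈ V)
    (hT : ∀ x ∈ V, f (T x) = f x) {x : H} (hx : x ∈ V) :
    gradient f (T x) = T (gradient f x) := by
  have h1 : HasGradientAt f (gradient f (T x)) (T x) :=
    ((hf _ (hTV x hx)).differentiableAt (hV.mem_nhds (hTV x hx))).hasGradientAt
  have h2 := h1.hasFDerivAt.comp x (T.toContinuousLinearEquiv.hasFDerivAt (x := x))
  have h3 := h2.congr_of_eventuallyEq (f₁ := f)
    (by filter_upwards [hV.mem_nhds hx] with y hy using (hT y hy).symm)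
  have h4 := ((hf x hx).differentiableAt (hV.mem_nhds hx)).hasGradientAt.hasFDerivAt.unique h3
  rw [← T.symm_apply_eq, eq_comm]
  refine ext_inner_right ℝ fun v => ?_
  have h5 := DFunLike.congr_fun h4 v
  simp only [InnerProductSpace.toDual_apply_apply, ContinuousLinearMap.comp_apply] at h5
  rw [h5, ← T.inner_map_map (T.symm _) v, T.apply_symm_apply]
  rfl

omit [CompleteSpace H] in
/-- The Gâteaux derivative at the origin of an equivariant field commutes with the symmetry. -/
theorem HasGateauxDerivAt.map_comm {f : H → H} {V : Set H} (hV : V ∈ 𝓝 (0 : H))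
    (hA : HasGateauxDerivAt f A 0) (T : H ≃ₗᵢ[ℝ] H) (hT : ∀ x ∈ V, f (T x) = T (f x)) (v : H) :
    A (T v) = T (A v) := by
  have h1 : HasDerivAt (fun t : ℝ => f (0 + t • T v)) (A (T v)) 0 := hA (T v)
  have h2 : HasDerivAt (fun t : ℝ => T (f (0 + t • v))) (T (A v)) 0 :=
    T.toContinuousLinearEquiv.hasFDerivAt.comp_hasDerivAt (0 : ℝ)
      (show HasDerivAt (fun t : ℝ => f (0 + t • v)) (A v) 0 from hA v)
  refine h1.unique (h2.congr_of_eventuallyEq ?_)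
  have h3 : Tendsto (fun t : ℝ => t • v) (𝓝 0) (𝓝 0) := by
    have h4 : Continuous fun t : ℝ => t • v := by fun_prop
    simpa using h4.tendsto 0
  filter_upwards [h3.eventually hV] with t ht
  rw [zero_add, zero_add, ← map_smul, hT _ ht]

omit [CompleteSpace H] in
theorem isometry_map_mem_orthogonal {T : H ≃ₗᵢ[ℝ] H} {W : Submodule ℝ H}
    (hW : ∀ v ∈ W, T.symm v ∈ W) {u : H} (hu : u ∈ Wᗮ) : T u ∈ Wᗮ := by
  rw [Submodule.mem_orthogonal'] at hu ⊢
  intro v hv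
  rw [← T.apply_symm_apply v, T.inner_map_map]
  exact hu _ (hW v hv)

section Commuting

variable {T : H ≃ₗᵢ[ℝ] H}

omit [CompleteSpace H] in
theorem map_symm_comm (hT : ∀ v, A (T v) = T (A v)) (v : H) : A (T.symm v) = T.symm (A v) := by
  rw [T.eq_symm_apply, ← hT, T.apply_symm_apply]

omit [CompleteSpace H] in
theorem isometry_map_mem_nullSpace (hT : ∀ v, A (T v) = T (A v)) {z : H} (hz : z ∈ nullSpace A) :
    T z ∈ nullSpace A := by
  rw [mem_nullSpace, hT, mem_nullSpace.1 hz, map_zero]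

omit [CompleteSpace H] in
theorem isometry_map_mem_nullSpace_orthogonal (hT : ∀ v, A (T v) = T (A v)) {u : H}
    (hu : u ∈ (nullSpace A)ᗮ) : T u ∈ (nullSpace A)ᗮ :=
  isometry_map_mem_orthogonal (fun _ => isometry_map_mem_nullSpace (map_symm_comm hT)) hu

omit [CompleteSpace H] in
theorem isometry_map_mem_negSpace (hT : ∀ v, A (T v) = T (A v)) {u : H} (hu : u ∈ negSpace A) :
    T u ∈ negSpace A :=
  map_mem_negSpace (T := (T.toContinuousLinearEquiv : H →L[ℝ] H)) hT hu

omit [CompleteSpace H] in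
theorem isometry_map_mem_posSpace (hT : ∀ v, A (T v) = T (A v)) {u : H} (hu : u ∈ posSpace A) :
    T u ∈ posSpace A := by
  refine isometry_map_mem_orthogonal (fun v hv => ?_) hu
  obtain ⟨z, hz, m, hm, rfl⟩ := Submodule.mem_sup.1 hv
  rw [map_add]
  exact Submodule.add_mem_sup (isometry_map_mem_nullSpace (map_symm_comm hT) hz)
    (isometry_map_mem_negSpace (map_symm_comm hT) hm)

omit [CompleteSpace H] in
theorem isometry_map_mem_Qset (hT : ∀ v, A (T v) = T (A v)) {r s : ℝ} {u : H}
    (hu : u ∈ Qset A r s) : T u ∈ Qset A r s := by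
  obtain ⟨p, hp, m, hm, hpr, hms, rfl⟩ := hu
  exact ⟨T p, isometry_map_mem_posSpace hT hp, T m, isometry_map_mem_negSpace hT hm,
    by rwa [T.norm_map], by rwa [T.norm_map], map_add _ _ _⟩

/-- A commuting isometry maps solutions of the projected equation to such. -/
theorem perpProj_isometry_eq_zero (hT : ∀ v, A (T v) = T (A v)) {v : H} (hv : perpProj A v = 0) :
    perpProj A (T v) = 0 := by
  have h1 : v = (nullSpace A).starProjection v := sub_eq_zero.1 hv
  have h2 : T v ∈ nullSpace A := by
    rw [h1]
    exact isometry_map_mem_nullSpace hT (Submodule.starProjection_apply_mem _ _)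
  exact sub_eq_zero.2 (Submodule.starProjection_eq_self_iff.2 h2).symm

end Commuting

end

end Splitting

theorem mainTheorem4 {H : Type*} [NormedAddCommGroup H] [InnerProductSpace ℝ H]
    [CompleteSpace H] (V : Set H) (L : H → ℝ) (B P Q : H → H →L[ℝ] H)
    (hL : Splitting.SplittingHypothesis V L B P Q)
    (hν : Splitting.nullSpace (B 0) ≠ ⊥)
    (n : ℕ) (G : Fin n → H → ℝ) (G'' : Fin n → H → H →L[ℝ] H)
    (hG : ∀ j, Splitting.PerturbationHypothesis V (G j) (G'' j))
    (r₀ s₀ ε₀ : ℝ) (hr₀ : 0 < r₀) (hs₀ : 0 < s₀) (hε₀ : 0 < ε₀) :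
    ∃ r s ε δ : ℝ, 0 < r ∧ r ≤ r₀ ∧ 0 < s ∧ s ≤ s₀ ∧ 0 < ε ∧ ε ≤ ε₀ ∧ 0 < δ ∧
      Splitting.Qset (B 0) r s ⊆ ((Splitting.nullSpace (B 0))ᗮ : Set H) ∧
      (∀ z ∈ Metric.closedBall (0 : H) ε ∩ (Splitting.nullSpace (B 0) : Set H),
        ∀ u ∈ closure (Splitting.Qset (B 0) r s), z + u ∈ V) ∧
      ∃ ψ : (Fin n → ℝ) × H → H,
        Splitting.IsImplicitMap (B 0) L G r s ε δ ψ ∧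
        (∀ ψ' : (Fin n → ℝ) × H → H, Splitting.IsImplicitMap (B 0) L G r s ε δ ψ' →
          Set.EqOn ψ' ψ (Splitting.paramDomain (B 0) n δ ε)) ∧
        (∀ (l : Fin n → ℝ) (z₁ z₂ : H),
          (l, z₁) ∈ Splitting.paramDomain (B 0) n δ ε →
          (l, z₂) ∈ Splitting.paramDomain (B 0) n δ ε →
          ‖ψ (l, z₁) - ψ (l, z₂)‖ ≤ 3 * ‖z₁ - z₂‖) ∧
        (∀ (d : ℕ) (K : Type*) [Group K] [TopologicalSpace K]
          [ChartedSpace (EuclideanSpace ℝ (Fin d)) K] [LieGroup (𝓡 d) ∞ K] [CompactSpace K]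
          (ρ : K →* (H ≃ₗᵢ[ℝ] H)),
          Continuous (fun p : K × H => ρ p.1 p.2) →
          (∀ g : K, ∀ x ∈ V, ρ g x ∈ V) →
          (∀ g : K, ∀ x ∈ V, L (ρ g x) = L x) →
          (∀ j, ∀ g : K, ∀ x ∈ V, G j (ρ g x) = G j x) →
          (∀ g : K, ∀ z ∈ Splitting.nullSpace (B 0), ρ g z ∈ Splitting.nullSpace (B 0)) ∧
          (∀ g : K, ∀ u ∈ (Splitting.nullSpace (B 0))ᗮ, ρ g u ∈ (Splitting.nullSpace (B 0))ᗮ) ∧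
          (∀ g : K, ∀ x ∈ V, gradient L (ρ g x) = ρ g (gradient L x)) ∧
          (∀ j, ∀ g : K, ∀ x ∈ V, gradient (G j) (ρ g x) = ρ g (gradient (G j) x)) ∧
          (∀ (l : Fin n → ℝ) (z : H), (l, z) ∈ Splitting.paramDomain (B 0) n δ ε →
            ∀ g : K, ψ (l, ρ g z) = ρ g (ψ (l, z)))) := by
  have hA : IsSelfAdjoint (B 0) := hL.selfAdjoint_B 0 hL.zero_mem
  obtain ⟨R, δ, c, M, hR, hδ, hc, hcM, hRV, hnear⟩ := hL.exists_isNearby hG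
  have hM : 0 < M := hc.trans_le hcM
  set N := Splitting.nullSpace (B 0) with hN
  -- `r = s = t` with `ε + 2 t < R`, so that all points `z + u` in question lie in the ball of
  -- radius `R`; the last bound on `ε` lets the fixed point `u` satisfy `‖u‖ ≤ t / 2`
  set t : ℝ := min (min r₀ s₀) (R / 4) with ht
  have ht0 : 0 < t := by positivity
  have htr : t ≤ r₀ := (min_le_left _ _).trans (min_le_left _ _)
  have hts : t ≤ s₀ := (min_le_left _ _).trans (min_le_right _ _)
  have htR : t ≤ R / 4 := min_le_right _ _
  set ε : ℝ := min ε₀ (min (R / 4) (c * (t / 2) / (2 * M))) with hε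
  have hε0 : 0 < ε := by positivity
  have hεR : ε ≤ R / 4 := (min_le_right _ _).trans (min_le_left _ _)
  have hεc : ε ≤ c * (t / 2) / (2 * M) := (min_le_right _ _).trans (min_le_right _ _)
  have hdom : ∀ m z, (m, z) ∈ Splitting.paramDomain (B 0) n δ ε ↔
      (∀ j, |m j| ≤ δ) ∧ ‖z‖ < ε ∧ z ∈ N :=
    fun m z => Splitting.mem_paramDomain
  have hQN := Splitting.Qset_subset_orthogonal hA t t
  have hQR : ∀ {z u : H}, ‖z‖ < ε → u ∈ Splitting.Qset (B 0) t t →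
      z + u ∈ Metric.ball (0 : H) R := by
    intro z u hz hu
    have h1 := Splitting.norm_lt_of_mem_Qset hu
    rw [mem_ball_zero_iff]
    exact (norm_add_le _ _).trans_lt (by linarith)
  have hder : ∀ m : Fin n → ℝ, ∀ x ∈ Metric.ball (0 : H) R, Splitting.HasGateauxDerivAt
      (Splitting.gradField L G m) (B x + ∑ j, m j • G'' j x) x := fun m x hx =>
    Splitting.hasGateauxDerivAt_gradField hL hG m (hRV hx)
  have heq : ∀ (m : Fin n → ℝ) (x : H), Splitting.perpProj (B 0) (gradient L x) +
      ∑ j, m j • Splitting.perpProj (B 0) (gradient (G j) x) =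
      Splitting.perpProj (B 0) (Splitting.gradField L G m x) := by
    intro m x
    simp only [Splitting.gradField, map_add, map_sum, map_smul]
  -- comparison of two solutions; it yields uniqueness, continuity and the Lipschitz bound
  have hcomp : ∀ m m' z z' u u', (m, z) ∈ Splitting.paramDomain (B 0) n δ ε →
      u ∈ Splitting.Qset (B 0) t t → u' ∈ Splitting.Qset (B 0) t t →
      Splitting.perpProj (B 0) (Splitting.gradField L G m (z + u)) = 0 →
      Splitting.perpProj (B 0) (Splitting.gradField L G m' (z' + u')) = 0 →
      c * ‖u - u'‖ ≤
        ‖Splitting.gradField L G m (z + u') - Splitting.gradField L G m' (z' + u')‖ := by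
    intro m m' z z' u u' hmz hu hu' h h'
    obtain ⟨hm, hz, -⟩ := (hdom m z).1 hmz
    exact Splitting.mul_norm_sub_le hA (hder m) (hnear m hm) _ (hQN hu) (hQN hu')
      (hQR hz hu) (hQR hz hu') h h'
  have huniq : ∀ m z u u', (m, z) ∈ Splitting.paramDomain (B 0) n δ ε →
      u ∈ Splitting.Qset (B 0) t t → u' ∈ Splitting.Qset (B 0) t t →
      Splitting.perpProj (B 0) (Splitting.gradField L G m (z + u)) = 0 →
      Splitting.perpProj (B 0) (Splitting.gradField L G m (z + u')) = 0 → u = u' := by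
    intro m z u u' hmz hu hu' h h'
    have h1 := hcomp m m z z u u' hmz hu hu' h h'
    rw [sub_self, norm_zero] at h1
    refine sub_eq_zero.1 (norm_le_zero_iff.1 ?_)
    exact nonpos_of_mul_nonpos_right h1 hc
  have hex : ∀ q : (Fin n → ℝ) × H, ∃ u, q ∈ Splitting.paramDomain (B 0) n δ ε →
      u ∈ Splitting.Qset (B 0) t t ∧
      Splitting.perpProj (B 0) (Splitting.gradField L G q.1 (q.2 + u)) = 0 := by
    rintro ⟨m, z⟩
    by_cases hq : (m, z) ∈ Splitting.paramDomain (B 0) n δ ε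
    · obtain ⟨hm, hz, -⟩ := (hdom m z).1 hq
      obtain ⟨u, huN, hut, hu⟩ := Splitting.exists_perpProj_eq_zero hA (hder m) (hnear m hm) hc hcM
        (Splitting.gradField_zero hL hG m) (half_pos ht0) (z := z) (by linarith)
        (hz.le.trans hεc)
      exact ⟨u, fun _ => ⟨Splitting.mem_Qset_of_norm_lt hA huN (by linarith), hu⟩⟩
    · exact ⟨0, fun h => absurd h hq⟩
  choose ψ hψ using hex
  refine ⟨t, t, ε, δ, ht0, htr, ht0, hts, hε0, min_le_left _ _, hδ, hQN, ?_, ψ, ?_, ?_, ?_, ?_⟩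
  · rintro z ⟨hz, -⟩ u hu
    have hu' : u ∈ Metric.closedBall (0 : H) (t + t) :=
      closure_minimal (fun v hv => by
        rw [mem_closedBall_zero_iff]
        exact (Splitting.norm_lt_of_mem_Qset hv).le) Metric.isClosed_closedBall hu
    rw [mem_closedBall_zero_iff] at hz hu'
    refine hRV ?_
    rw [mem_ball_zero_iff]
    exact (norm_add_le _ _).trans_lt (by linarith)
  · refine ⟨?_, fun q hq => (hψ q hq).1, ?_, fun q hq => by rw [heq]; exact (hψ q hq).2⟩
    · rintro ⟨m', z'⟩ hq'
      obtain ⟨hm', hz', -⟩ := (hdom m' z').1 hq'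
      set v := ψ (m', z') with hv
      have hvQ := (hψ _ hq').1
      have hzv : z' + v ∈ V := hRV (hQR hz' hvQ)
      have h1 : Filter.Tendsto (fun q : (Fin n → ℝ) × H => Splitting.gradField L G q.1 (q.2 + v))
          (nhds (m', z')) (nhds (Splitting.gradField L G m' (z' + v))) :=
        Splitting.tendsto_gradField_add hL hG hzv
      have h4 := ((tendsto_iff_norm_sub_tendsto_zero.1 h1).const_mul c⁻¹).mono_left
        (nhdsWithin_le_nhds (s := Splitting.paramDomain (B 0) n δ ε))
      rw [mul_zero] at h4
      refine tendsto_iff_norm_sub_tendsto_zero.2 (squeeze_zero' ?_ ?_ h4)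
      · exact Filter.Eventually.of_forall fun _ => norm_nonneg _
      · filter_upwards [self_mem_nhdsWithin] with q hq
        rw [inv_mul_eq_div, le_div_iff₀ hc, mul_comm]
        exact hcomp _ _ _ _ _ _ hq (hψ q hq).1 hvQ (hψ q hq).2 (hψ _ hq').2
    · rintro ⟨m, z⟩ hq
      obtain ⟨hm, -, -⟩ := (hdom m z).1 hq
      have h0 : (m, (0 : H)) ∈ Splitting.paramDomain (B 0) n δ ε :=
        (hdom m 0).2 ⟨hm, by rwa [norm_zero], N.zero_mem⟩
      refine huniq m 0 _ 0 h0 (hψ _ h0).1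
        (Splitting.mem_Qset_of_norm_lt hA (Submodule.zero_mem _) (by rwa [norm_zero]))
        (hψ _ h0).2 ?_
      rw [add_zero, Splitting.gradField_zero hL hG, map_zero]
  · intro ψ' hψ' q hq
    exact huniq q.1 q.2 _ _ hq (hψ'.mapsTo hq) (hψ q hq).1
      (by rw [← heq]; exact hψ'.equation q hq) (hψ q hq).2
  · intro m z₁ z₂ h₁ h₂
    obtain ⟨hm, hz₁, hz₁N⟩ := (hdom m z₁).1 h₁
    obtain ⟨-, hz₂, hz₂N⟩ := (hdom m z₂).1 h₂
    have h3 := hcomp m m z₁ z₂ _ _ h₁ (hψ _ h₁).1 (hψ _ h₂).1 (hψ _ h₁).2 (hψ _ h₂).2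
    -- the Hessians are small on the null space, which contains `z₁ - z₂`
    have h4 := Splitting.norm_sub_le_of_sub_mem_nullSpace (hder m) (hnear m hm)
      (hQR hz₁ (hψ _ h₂).1) (hQR hz₂ (hψ _ h₂).1)
      (by rw [add_sub_add_right_eq_sub]; exact N.sub_mem hz₁N hz₂N)
    rw [add_sub_add_right_eq_sub] at h4
    have h5 : c * ‖ψ (m, z₁) - ψ (m, z₂)‖ ≤ c * (2 * ‖z₁ - z₂‖) := by linarith
    have h6 := le_of_mul_le_mul_left h5 hc
    linarith [norm_nonneg (z₁ - z₂)]
  · intro d K _ _ _ _ _ ρ _ hρV hρL hρG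
    have hgL : ∀ g : K, ∀ x ∈ V, gradient L (ρ g x) = ρ g (gradient L x) := fun g x hx =>
      Splitting.gradient_comp_isometry hL.isOpen (hL.contDiffOn.differentiableOn one_ne_zero) (ρ g)
        (hρV g) (hρL g) hx
    have hgG : ∀ j, ∀ g : K, ∀ x ∈ V, gradient (G j) (ρ g x) = ρ g (gradient (G j) x) :=
      fun j g x hx => Splitting.gradient_comp_isometry hL.isOpen
        ((hG j).contDiffOn.differentiableOn one_ne_zero) (ρ g) (hρV g) (hρG j g) hx
    have hcomm : ∀ (g : K) (v : H), B 0 (ρ g v) = ρ g (B 0 v) := fun g =>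
      (hL.gateaux 0 hL.zero_mem).map_comm hL.mem_nhds (ρ g) (hgL g)
    refine ⟨fun g z hz => Splitting.isometry_map_mem_nullSpace (hcomm g) hz,
      fun g u hu => Splitting.isometry_map_mem_nullSpace_orthogonal (hcomm g) hu, hgL, hgG, ?_⟩
    intro m z hq g
    obtain ⟨hm, hz, hzN⟩ := (hdom m z).1 hq
    have hq' : (m, ρ g z) ∈ Splitting.paramDomain (B 0) n δ ε :=
      (hdom _ _).2 ⟨hm, by rwa [LinearIsometryEquiv.norm_map],
        Splitting.isometry_map_mem_nullSpace (hcomm g) hzN⟩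
    refine huniq m (ρ g z) _ _ hq' (hψ _ hq').1
      (Splitting.isometry_map_mem_Qset (hcomm g) (hψ _ hq).1) (hψ _ hq').2 ?_
    have hx : z + ψ (m, z) ∈ V := hRV (hQR hz (hψ _ hq).1)
    have h1 : Splitting.gradField L G m (ρ g z + ρ g (ψ (m, z))) =
        ρ g (Splitting.gradField L G m (z + ψ (m, z))) := by
      simp only [Splitting.gradField, ← map_add, hgL g _ hx, fun j => hgG j g _ hx, ← map_smul,
        ← map_sum]
    rw [h1]
    exact Splitting.perpProj_isometry_eq_zero (hcomm g) (hψ _ hq).2
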